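/- Let $t>0$ and $T=[-t,t]^2$. Let $X=\{X(s):s\in\mathbb R^2\}$ be a real-valued random field on a probability space $(\Omega,\mathcal F,\mathbb P)$ with $C^2$ sample paths; write $X_k$ and $X_{kk}$ ($k=1,2$) for its first and pure second partial derivatives. Assume that for every $v\in\mathbb R$ the following hold almost surely: (1) $X$ has no critical point in $T$ at the level $v$; (2) the restriction of $X$ to each of the four faces (open edges) of $\partial T$ has no local extremum at the level $v$; (3) for $k\in\{1,2\}$ there is no $s\in T$ with $X(s)-v=X_k(s)=X_{kk}(s)=0$. For $u\in\mathbb R$ let $E_X(u)=\{s\in\mathbb R^2:X(s)\ge u\}$ and $P_X^T(u)=\mathcal H^1\big(T\cap\partial E_X(u)\big)$, where $\mathcal H^1$ is the one-dimensional Hausdorff measure. For $\epsilon>0$ let $s_{i,j}=(-t+i\epsilon,-t+j\epsilon)$ for $i,j\in\mathbb N_0$, let $\mathcal G^{(T,\epsilon)}=\{s_{i,j}:i,j\in\mathbb N_0\}\cap T$, let $M$ be the number of rows (equivalently, columns) of this grid, and let $\zeta_{i,j}=1$ if $X(s_{i,j})\ge u$ and $\zeta_{i,j}=0$ otherwise.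 For an integer $m\ge1$ let $I$ be the set of the multiples of $m$ in $\{0,\dots,M-1\}$, and for $a,b\in I$ put $$N_h(a,b)=\sum_{i=a}^{\min(a+m-1,\,M-1)}\ \sum_{j=b}^{\min(b+m-1,\,M-2)}|\zeta_{i,j}-\zeta_{i,j+1}|,\qquad N_v(a,b)=\sum_{i=a}^{\min(a+m-1,\,M-2)}\ \sum_{j=b}^{\min(b+m-1,\,M-1)}|\zeta_{i,j}-\zeta_{i+1,j}|,$$ $$\hat P_X^{(2)}(\epsilon,m;T,u)=\epsilon\sum_{a\in I}\sum_{b\in I}\sqrt{N_h(a,b)^2+N_v(a,b)^2}.$$ Let $(m_n)_{n\ge1}$ be a non-decreasing sequence of positive integers tending to $\infty$, and let $(\epsilon_n)_{n\ge1}$ be a sequence of positive reals such that $m_n\epsilon_n\to0$ and the four vertices of $T$ belong to $\mathcal G^{(T,\epsilon_n)}$ for all $n$. Then, for every fixed $u\in\mathbb R$, almost surely $P_X^T(u)<\infty$ and $$\hat P_X^{(2)}(\epsilon_n,m_n;T,u)\longrightarrow P_X^T(u)\qquad(n\to\infty).$$ -/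

import Mathlib

open MeasureTheory Filter Topology
open scoped ENNReal

noncomputable section

namespace Excursion

/-- The Euclidean plane. -/
abbrev Plane : Type := EuclideanSpace ℝ (Fin 2)

/-- The square `T = [-t, t]²`. -/
def square (t : ℝ) : Set Plane := {s | ∀ k, s k ∈ Set.Icc (-t) t}

/-- The four vertices of the square. -/
def vertices (t : ℝ) : Set Plane := {!₂[-t, -t], !₂[-t, t], !₂[t, -t], !₂[t, t]}

/-- The face of the square boundary on which the coordinate `k` is equal to `c` (for `c = t` or
`c = -t`). As usual for a stratified boundary, the face does not contain its two end points. -/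
def face (t : ℝ) (k : Fin 2) (c : ℝ) : Set Plane :=
  {s | s k = c ∧ ∀ l, l ≠ k → s l ∈ Set.Ioo (-t) t}

/-- The excursion set of `f` at the level `u`. -/
def excursionSet (f : Plane → ℝ) (u : ℝ) : Set Plane := {s | u ≤ f s}

/-- The part in the square of the boundary of the excursion set. -/
def excursionBoundary (f : Plane → ℝ) (t u : ℝ) : Set Plane :=
  square t ∩ frontier (excursionSet f u)

/-- The perimeter of the excursion set in the square, by the one-dimensional Hausdorff measure. -/
def perimeter (f : Plane → ℝ) (t u : ℝ) : ℝ≥0∞ := μH[1] (excursionBoundary f t u)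

/-- The partial derivative of `f` in the coordinate direction `k`. -/
def partialDeriv (k : Fin 2) (f : Plane → ℝ) (s : Plane) : ℝ :=
  fderiv ℝ f s (EuclideanSpace.single k 1)

/-- The three conditions on a sample path `f` at the level `u` in the square. -/
structure NonDegenerateAt (f : Plane → ℝ) (t u : ℝ) : Prop where
  no_critical_point : ¬ ∃ s ∈ square t, f s = u ∧ fderiv ℝ f s = 0
  no_face_extremum : ∀ k : Fin 2, ∀ c ∈ ({-t, t} : Set ℝ),
    ¬ ∃ s ∈ face t k c, f s = u ∧ IsLocalExtrOn f (face t k c) s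
  no_flat_point : ∀ k : Fin 2, ¬ ∃ s ∈ square t,
    f s - u = 0 ∧ partialDeriv k f s = 0 ∧ partialDeriv k (partialDeriv k f) s = 0

/-- A real-valued random field on the plane with sample paths of class `C²`. -/
structure IsSmoothField {Ω : Type*} [MeasurableSpace Ω] (X : Ω → Plane → ℝ) : Prop where
  measurable : ∀ s, Measurable fun ω => X ω s
  contDiff : ∀ ω, ContDiff ℝ 2 (X ω)

/-- At each level, almost every sample path satisfies the three conditions. -/
def IsNonDegenerateField {Ω : Type*} [MeasurableSpace Ω] (P : Measure Ω) (X : Ω → Plane → ℝ)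
    (t : ℝ) : Prop :=
  ∀ u : ℝ, ∀ᵐ ω ∂P, NonDegenerateAt (X ω) t u

/-- The point `s_{i,j}` of the square lattice with origin `(-t, -t)` and mesh `ε`. -/
def gridPoint (t ε : ℝ) (i j : ℕ) : Plane := !₂[-t + i * ε, -t + j * ε]

/-- The grid of sampling locations in the square. -/
def grid (t ε : ℝ) : Set Plane := {s | ∃ i j : ℕ, s = gridPoint t ε i j} ∩ square t

/-- The number `M` of rows (equivalently, of columns) of the grid. -/
def gridSize (t ε : ℝ) : ℕ := Set.ncard {i : ℕ | ∃ j : ℕ, gridPoint t ε i j ∈ square t}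

theorem gridSize_eq {t ε : ℝ} (ht : 0 ≤ t) (hε : 0 < ε) :
    gridSize t ε = ⌊2 * t / ε⌋₊ + 1 := by
  have h : {i : ℕ | ∃ j : ℕ, gridPoint t ε i j ∈ square t}
      = (Finset.range (⌊2 * t / ε⌋₊ + 1) : Finset ℕ) := by
    ext i
    have h1 : i ≤ ⌊2 * t / ε⌋₊ ↔ (i : ℝ) * ε ≤ 2 * t := by
      rw [Nat.le_floor_iff (by positivity), le_div_iff₀ hε]
    have h2 : 0 ≤ (i : ℝ) * ε := by positivity
    simp only [Set.mem_ofPred_eq, Finset.coe_range, Set.mem_Iio, Nat.lt_succ_iff, h1, square,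
      gridPoint, Fin.forall_fin_two, Set.mem_Icc]
    constructor
    · rintro ⟨j, ⟨_, h3⟩, _⟩
      simp at h3
      linarith
    · intro h3
      refine ⟨0, ⟨by simpa using h2, ?_⟩, ?_, ?_⟩ <;> simp <;> linarith
  rw [gridSize, h, Set.ncard_coe_finset, Finset.card_range]

/-- The binary observation `ζ_{i,j}`: is `f ≥ u` at the point `s_{i,j}`? -/
def zeta (f : Plane → ℝ) (t ε u : ℝ) (i j : ℕ) : ℝ :=
  (excursionSet f u).indicator (fun _ => 1) (gridPoint t ε i j)

/-- The indices in `{0, …, M - 1}` that are multiples of `m`. -/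
def blockIndices (t ε : ℝ) (m : ℕ) : Finset ℕ :=
  (Finset.range (gridSize t ε)).filter fun i => i ≡ 0 [MOD m]

/-- The count `N_h(a, b)`: the sum over `a ≤ i ≤ min (a + m - 1) (M - 1)` and
`b ≤ j ≤ min (b + m - 1) (M - 2)`. -/
def countH (f : Plane → ℝ) (t ε u : ℝ) (m a b : ℕ) : ℝ :=
  ∑ i ∈ Finset.Ico a (min (a + m) (gridSize t ε)),
    ∑ j ∈ Finset.Ico b (min (b + m) (gridSize t ε - 1)),
      |zeta f t ε u i j - zeta f t ε u i (j + 1)|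

/-- The count `N_v(a, b)`: the sum over `a ≤ i ≤ min (a + m - 1) (M - 2)` and
`b ≤ j ≤ min (b + m - 1) (M - 1)`. -/
def countV (f : Plane → ℝ) (t ε u : ℝ) (m a b : ℕ) : ℝ :=
  ∑ i ∈ Finset.Ico a (min (a + m) (gridSize t ε - 1)),
    ∑ j ∈ Finset.Ico b (min (b + m) (gridSize t ε)),
      |zeta f t ε u i j - zeta f t ε u (i + 1) j|

/-- The perimeter estimator built on the `p`-norm, with pixel width `ε` and block size `m`. -/
def perimeterEstimator (p : ℝ≥0∞) (f : Plane → ℝ) (ε : ℝ) (m : ℕ) (t u : ℝ) : ℝ :=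
  ε * ∑ a ∈ blockIndices t ε m, ∑ b ∈ blockIndices t ε m,
    ‖WithLp.toLp p ![countH f t ε u m a b, countV f t ε u m a b]‖

end Excursion

end

noncomputable section

namespace Excursion

/-! The statement is pathwise: fix a nondegenerate path `f`. A point at the level `u` that is not
critical lies in the frontier of the excursion set, so the set to measure is the compact level set L
= {f = u} ∩ T, on which the gradient is bounded away from 0.

In a block that meets L and has small side w = mε, the gradient is within η of a fixed form ℓ, so ℓ
nearly does not vary on L and L is nearly a straight segment there. Its length is then nearly the
Euclidean norm of the lengths of its two projections (`abs_norm_proj_sub_hausdorffMeasure_le`). If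
moreover neither partial derivative changes sign in the block, each grid line crosses the level at
most once and the projections are intervals, so ε times each count is a projection length up to 4ε
(`abs_crossings_sub_volume_le`). The error in such a block is O(ε + ηw) = w · O(1/m + η).

The exceptional blocks lie near points of L where a partial derivative vanishes. There the second
derivative in the same direction is nonzero, and this is used twice: such points are isolated, hence
finite in number (`finite_tangent_points`), and along every grid line of a small block `f` is
monotone, convex or concave, so the level is crossed at most twice and the error is still O(w)
(`blockCount_le`).

Locally L is bi-Lipschitz to its projection to an axis, so O(1/w) blocks meet L, and O(δ/w + 1) of
them do so within δ of an exceptional point (`card_corners_near_le`). The total error is O(δ + w) +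
O(1/m + η), with constants independent of δ and η (`exists_error_bound`). First n tends to infinity,
then δ and η tend to 0. -/

/-! ### Linear forms, projections and one-dimensional Hausdorff measure -/

/-- The length of the gradient represented by the linear form `ℓ`. -/
def gradNorm (ℓ : Plane →L[ℝ] ℝ) : ℝ :=
  √(ℓ (EuclideanSpace.single 0 1) ^ 2 + ℓ (EuclideanSpace.single 1 1) ^ 2)

theorem apply_eq_coord (ℓ : Plane →L[ℝ] ℝ) (d : Plane) :
    ℓ d = d 0 * ℓ (EuclideanSpace.single 0 1) + d 1 * ℓ (EuclideanSpace.single 1 1) := by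
  have h : d = d 0 • EuclideanSpace.single 0 (1 : ℝ) + d 1 • EuclideanSpace.single 1 (1 : ℝ) := by
    ext i; fin_cases i <;> simp
  conv_lhs => rw [h]
  simp

theorem plane_norm (d : Plane) : ‖d‖ = √(d 0 ^ 2 + d 1 ^ 2) := by
  simp [EuclideanSpace.norm_eq, Fin.sum_univ_two]

theorem abs_coord_le_norm (d : Plane) (k : Fin 2) : |d k| ≤ ‖d‖ := by
  simpa using PiLp.norm_apply_le d k

/-- With θ and σ the inner and cross products of the gradient (p, q) and the displacement (x, y),
Lagrange's identity gives σ² + θ² = (gr)², and g²x = pθ + qσ. A small θ forces |σ| ≈ gr, hence g|x|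
≈ |q|r; each approximation costs ηr. -/
theorem coord_near_aux {p q x y g r η : ℝ} (hg : 0 ≤ g) (hr : 0 ≤ r) (hη : 0 ≤ η)
    (hg2 : g ^ 2 = p ^ 2 + q ^ 2) (hr2 : r ^ 2 = x ^ 2 + y ^ 2)
    (h : |x * p + y * q| ≤ η * r) : |g * |x| - |q| * r| ≤ 2 * η * r := by
  rcases hg.eq_or_lt with rfl | hg
  · have hq : q = 0 := by nlinarith [sq_nonneg p, sq_nonneg q]
    subst hq
    simp
    positivity
  set θ := x * p + y * q
  set σ := x * q - y * p
  have hp1 : |p| ≤ g := abs_le_of_sq_le_sq (by nlinarith [sq_nonneg q]) hg.le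
  have hq1 : |q| ≤ g := abs_le_of_sq_le_sq (by nlinarith [sq_nonneg p]) hg.le
  have hs : σ ^ 2 + θ ^ 2 = (g * r) ^ 2 := by rw [mul_pow, hg2, hr2]; ring
  have hs1 : |σ| ≤ g * r := by
    refine abs_le_of_sq_le_sq (by nlinarith [sq_nonneg θ]) (by positivity)
  have hs2 : g * r ≤ |σ| + |θ| := by
    refine (le_abs_self _).trans (abs_le_of_sq_le_sq ?_ (by positivity))
    nlinarith [sq_abs σ, sq_abs θ, mul_nonneg (abs_nonneg σ) (abs_nonneg θ)]
  have e1 : g * (g * x) = p * θ + q * σ := by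
    rw [← mul_assoc, ← sq, hg2]; ring
  have e2 : |g * (g * x) - q * σ| ≤ g * (η * r) := by
    rw [e1, add_sub_cancel_right, abs_mul]
    exact mul_le_mul hp1 h (abs_nonneg _) hg.le
  have e3 : |g * (g * |x|) - (|q| * |σ|)| ≤ g * (η * r) := by
    have := (abs_abs_sub_abs_le (g * (g * x)) (q * σ)).trans e2
    rwa [abs_mul, abs_mul, abs_mul, abs_of_pos hg] at this
  have e4 : |(|q| * |σ|) - |q| * (g * r)| ≤ g * (η * r) := by
    rw [← mul_sub, abs_mul, abs_abs]
    refine mul_le_mul hq1 ?_ (abs_nonneg _) hg.le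
    rw [abs_le]; constructor <;> linarith [h, abs_nonneg θ]
  have e5 : g * |g * |x| - |q| * r| ≤ g * (2 * η * r) := by
    rw [← abs_of_pos hg, ← abs_mul, abs_of_pos hg]
    calc _ = |(g * (g * |x|) - |q| * |σ|) + ((|q| * |σ|) - |q| * (g * r))| := by congr 1; ring
      _ ≤ _ := (abs_add_le _ _).trans (by linarith)
  exact le_of_mul_le_mul_left e5 hg

/-- In `Fin 2` the index `k + 1` is the other axis: a direction orthogonal to the gradient has its
coordinate `k` proportional to the other component of the gradient. -/
theorem abs_coord_near {ℓ : Plane →L[ℝ] ℝ} {d : Plane} {η : ℝ} (hη : 0 ≤ η)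
    (h : |ℓ d| ≤ η * ‖d‖) (k : Fin 2) :
    |gradNorm ℓ * |d k| - |ℓ (EuclideanSpace.single (k + 1) 1)| * ‖d‖| ≤ 2 * η * ‖d‖ := by
  have hr2 : ‖d‖ ^ 2 = d 0 ^ 2 + d 1 ^ 2 := by rw [plane_norm, Real.sq_sqrt (by positivity)]
  have hg2 : gradNorm ℓ ^ 2 = ℓ (EuclideanSpace.single 0 1) ^ 2
      + ℓ (EuclideanSpace.single 1 1) ^ 2 := by
    rw [gradNorm, Real.sq_sqrt (by positivity)]
  rw [apply_eq_coord] at h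
  have hg : 0 ≤ gradNorm ℓ := Real.sqrt_nonneg _
  fin_cases k
  · exact coord_near_aux hg (norm_nonneg d) hη hg2 hr2 h
  · exact coord_near_aux hg (norm_nonneg d) hη (hg2.trans (add_comm _ _))
      (hr2.trans (add_comm _ _)) (by rwa [add_comm] at h)

theorem exists_gradNorm_le (ℓ : Plane →L[ℝ] ℝ) :
    ∃ k : Fin 2, gradNorm ℓ ≤ 2 * |ℓ (EuclideanSpace.single (k + 1) 1)| := by
  by_contra! h
  have h0 := h 0
  have h1 := h 1
  have hg2 : gradNorm ℓ ^ 2 = ℓ (EuclideanSpace.single 0 1) ^ 2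
      + ℓ (EuclideanSpace.single 1 1) ^ 2 := by
    rw [gradNorm, Real.sq_sqrt (by positivity)]
  have e1 : (1 : Fin 2) + 1 = 0 := rfl
  rw [e1] at h1
  rw [zero_add] at h0
  rw [← sq_abs (ℓ (EuclideanSpace.single 0 1)), ← sq_abs (ℓ (EuclideanSpace.single 1 1))] at hg2
  nlinarith [abs_nonneg (ℓ (EuclideanSpace.single 0 1)), abs_nonneg (ℓ (EuclideanSpace.single 1 1))]

/-- A set on which a linear form nearly does not vary is controlled by one of its projections. -/
theorem exists_norm_sub_le_coord {ℓ : Plane →L[ℝ] ℝ} {A : Set Plane} {η : ℝ} (hη : 0 ≤ η)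
    (hg : 0 < gradNorm ℓ) (hηg : 8 * η ≤ gradNorm ℓ)
    (h : ∀ P ∈ A, ∀ Q ∈ A, |ℓ (P - Q)| ≤ η * ‖P - Q‖) :
    ∃ k : Fin 2, ∀ P ∈ A, ∀ Q ∈ A, ‖P - Q‖ ≤ 4 * |P k - Q k| := by
  obtain ⟨k, hk⟩ := exists_gradNorm_le ℓ
  refine ⟨k, fun P hP Q hQ => ?_⟩
  have h1 := (abs_le.1 (abs_coord_near hη (h P hP Q hQ) k)).1
  have h2 : (P - Q) k = P k - Q k := rfl
  rw [h2] at h1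
  -- The selected component is at least g/2 and 2η ≤ g/4, which leaves g/4: this is the factor 4.
  have h3 : gradNorm ℓ * ‖P - Q‖ ≤ gradNorm ℓ * (4 * |P k - Q k|) := by
    nlinarith [norm_nonneg (P - Q)]
  exact le_of_mul_le_mul_left h3 hg

/-- The inverse of `π` on `A` is `K`-Lipschitz from a subset of the line, where `μH[1]` is Lebesgue
measure. -/
theorem hausdorffMeasure_le_of_le_dist {A : Set Plane} {π : Plane → ℝ} {K : NNReal}
    (h : ∀ P ∈ A, ∀ Q ∈ A, dist P Q ≤ K * dist (π P) (π Q)) :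
    μH[1] A ≤ K * volume (π '' A) := by
  have hinj : Set.InjOn π A := by
    intro P hP Q hQ hPQ
    have := h P hP Q hQ
    rw [hPQ, dist_self, mul_zero] at this
    exact dist_le_zero.1 this
  rcases A.eq_empty_or_nonempty with rfl | hA
  · simp
  have : Nonempty Plane := ⟨0⟩
  have hl : LipschitzOnWith K (Function.invFunOn π A) (π '' A) := by
    refine LipschitzOnWith.of_dist_le_mul ?_
    rintro _ ⟨P, hP, rfl⟩ _ ⟨Q, hQ, rfl⟩
    rw [hinj.leftInvOn_invFunOn hP, hinj.leftInvOn_invFunOn hQ]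
    exact h P hP Q hQ
  have := hl.hausdorffMeasure_image_le zero_le_one
  rw [hinj.leftInvOn_invFunOn.image_image, hausdorffMeasure_real] at this
  simpa using this

theorem volume_image_le_of_dist_le {A : Set Plane} {π : Plane → ℝ} {K : NNReal}
    (h : ∀ P ∈ A, ∀ Q ∈ A, dist (π P) (π Q) ≤ K * dist P Q) :
    volume (π '' A) ≤ K * μH[1] A := by
  have := (LipschitzOnWith.of_dist_le_mul h).hausdorffMeasure_image_le zero_le_one
  rw [hausdorffMeasure_real] at this
  simpa using this

theorem norm_pair (x y : ℝ) : ‖WithLp.toLp 2 ![x, y]‖ = √(x ^ 2 + y ^ 2) := by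
  simp [EuclideanSpace.norm_eq, Fin.sum_univ_two]

theorem norm_pair_le (x y : ℝ) : ‖WithLp.toLp 2 ![x, y]‖ ≤ |x| + |y| := by
  rw [norm_pair]
  refine Real.sqrt_le_iff.2 ⟨by positivity, ?_⟩
  nlinarith [sq_abs x, sq_abs y, mul_nonneg (abs_nonneg x) (abs_nonneg y)]

theorem abs_norm_pair_sub_le (x y x' y' : ℝ) :
    |‖WithLp.toLp 2 ![x, y]‖ - ‖WithLp.toLp 2 ![x', y']‖| ≤ |x - x'| + |y - y'| := by
  refine (abs_norm_sub_norm_le _ _).trans ?_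
  rw [← WithLp.toLp_sub]
  simpa using norm_pair_le (x - x') (y - y')

/-- On `A` the projection multiplies distances by q/g up to an error 2η/g; the upper and lower
Lipschitz bounds transfer this to the measures. -/
theorem abs_volume_proj_sub_le {ℓ : Plane →L[ℝ] ℝ} {A : Set Plane} {η : ℝ} (hη : 0 ≤ η)
    (hg : 0 < gradNorm ℓ) (h : ∀ P ∈ A, ∀ Q ∈ A, |ℓ (P - Q)| ≤ η * ‖P - Q‖)
    (hA : μH[1] A ≠ ∞) (k : Fin 2) :
    |(volume ((fun s : Plane => s k) '' A)).toReal
      - |ℓ (EuclideanSpace.single (k + 1) 1)| / gradNorm ℓ * (μH[1] A).toReal|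
      ≤ 2 * η / gradNorm ℓ * (μH[1] A).toReal := by
  set q := |ℓ (EuclideanSpace.single (k + 1) 1)|
  set g := gradNorm ℓ
  have hq : 0 ≤ q := abs_nonneg _
  have key : ∀ P ∈ A, ∀ Q ∈ A, |g * |P k - Q k| - q * ‖P - Q‖| ≤ 2 * η * ‖P - Q‖ :=
    fun P hP Q hQ => abs_coord_near hη (h P hP Q hQ) k
  have up : volume ((fun s : Plane => s k) '' A)
      ≤ (((q + 2 * η) / g).toNNReal : ℝ≥0∞) * μH[1] A := by
    refine volume_image_le_of_dist_le fun P hP Q hQ => ?_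
    rw [Real.coe_toNNReal _ (by positivity), Real.dist_eq, dist_eq_norm, div_mul_eq_mul_div,
      le_div_iff₀ hg]
    have := (abs_le.1 (key P hP Q hQ)).2
    linarith
  have hfin : volume ((fun s : Plane => s k) '' A) ≠ ∞ :=
    ne_top_of_le_ne_top (ENNReal.mul_ne_top ENNReal.coe_ne_top hA) up
  have up' := ENNReal.toReal_mono (ENNReal.mul_ne_top ENNReal.coe_ne_top hA) up
  rw [ENNReal.toReal_mul, ENNReal.coe_toReal, Real.coe_toNNReal _ (by positivity)] at up'
  have hh : 0 ≤ (μH[1] A).toReal := ENNReal.toReal_nonneg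
  rw [abs_le]
  constructor
  -- For q ≤ 2η the projection may have no Lipschitz inverse, but then the lower bound to be proved
  -- is not positive.
  · by_cases hc : q ≤ 2 * η
    · have : (q / g) * (μH[1] A).toReal ≤ 2 * η / g * (μH[1] A).toReal := by gcongr
      have := ENNReal.toReal_nonneg (a := volume ((fun s : Plane => s k) '' A))
      linarith
    · push Not at hc
      have hqη : 0 < q - 2 * η := by linarith
      have lo : μH[1] A ≤ ((g / (q - 2 * η)).toNNReal : ℝ≥0∞)
          * volume ((fun s : Plane => s k) '' A) := by
        refine hausdorffMeasure_le_of_le_dist fun P hP Q hQ => ?_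
        rw [Real.coe_toNNReal _ (by positivity), Real.dist_eq, dist_eq_norm, div_mul_eq_mul_div,
          le_div_iff₀ hqη]
        have := (abs_le.1 (key P hP Q hQ)).1
        linarith
      have lo' := ENNReal.toReal_mono (ENNReal.mul_ne_top ENNReal.coe_ne_top hfin) lo
      rw [ENNReal.toReal_mul, ENNReal.coe_toReal, Real.coe_toNNReal _ (by positivity),
        div_mul_eq_mul_div, le_div_iff₀ hqη] at lo'
      have : q / g * (μH[1] A).toReal - 2 * η / g * (μH[1] A).toReal
          ≤ (volume ((fun s : Plane => s k) '' A)).toReal := by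
        rw [← sub_mul, ← sub_div, div_mul_eq_mul_div, div_le_iff₀ hg]
        linarith
      linarith
  · have : (q + 2 * η) / g * (μH[1] A).toReal
      = q / g * (μH[1] A).toReal + 2 * η / g * (μH[1] A).toReal := by ring
    linarith

/-- The length of a set on which a linear form nearly does not vary is nearly the Euclidean norm
of the lengths of its two projections. -/
theorem abs_norm_proj_sub_hausdorffMeasure_le {ℓ : Plane →L[ℝ] ℝ} {A : Set Plane} {η : ℝ}
    (hη : 0 ≤ η) (hg : 0 < gradNorm ℓ) (h : ∀ P ∈ A, ∀ Q ∈ A, |ℓ (P - Q)| ≤ η * ‖P - Q‖)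
    (hA : μH[1] A ≠ ∞) :
    |‖WithLp.toLp 2 ![(volume ((fun s : Plane => s 0) '' A)).toReal,
        (volume ((fun s : Plane => s 1) '' A)).toReal]‖ - (μH[1] A).toReal|
      ≤ 4 * η / gradNorm ℓ * (μH[1] A).toReal := by
  have h0 := abs_volume_proj_sub_le hη hg h hA 0
  have h1 := abs_volume_proj_sub_le hη hg h hA 1
  set L := (μH[1] A).toReal
  have hL : 0 ≤ L := ENNReal.toReal_nonneg
  set g := gradNorm ℓ with hgdef
  have e1 : (1 : Fin 2) + 1 = 0 := rfl
  rw [e1] at h1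
  rw [zero_add] at h0
  -- The two ideal scaling factors are the components of a unit vector.
  have hn : ‖WithLp.toLp 2 ![|ℓ (EuclideanSpace.single 1 1)| / g * L,
      |ℓ (EuclideanSpace.single 0 1)| / g * L]‖ = L := by
    rw [norm_pair]
    have hg2 : g ^ 2 = ℓ (EuclideanSpace.single 0 1) ^ 2 + ℓ (EuclideanSpace.single 1 1) ^ 2 := by
      rw [hgdef, gradNorm, Real.sq_sqrt (by positivity)]
    have : (|ℓ (EuclideanSpace.single 1 1)| / g * L) ^ 2
        + (|ℓ (EuclideanSpace.single 0 1)| / g * L) ^ 2 = L ^ 2 := by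
      rw [mul_pow, mul_pow, div_pow, div_pow, sq_abs, sq_abs, ← add_mul, ← add_div, add_comm,
        ← hg2, div_self (by positivity), one_mul]
    rw [this, Real.sqrt_sq hL]
  have := abs_norm_pair_sub_le (volume ((fun s : Plane => s 0) '' A)).toReal
    (volume ((fun s : Plane => s 1) '' A)).toReal
    (|ℓ (EuclideanSpace.single 1 1)| / g * L) (|ℓ (EuclideanSpace.single 0 1)| / g * L)
  rw [hn] at this
  have e : 4 * η / g * L = 2 * η / g * L + 2 * η / g * L := by ring
  linarith

theorem hausdorffMeasure_le_of_coord {A : Set Plane} {k : Fin 2} {w : ℝ}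
    (h : ∀ P ∈ A, ∀ Q ∈ A, ‖P - Q‖ ≤ 4 * |P k - Q k|)
    (hw : ∀ P ∈ A, ∀ Q ∈ A, |P k - Q k| ≤ w) : μH[1] A ≤ ENNReal.ofReal (4 * w) := by
  have h1 : μH[1] A ≤ ((4 : NNReal) : ℝ≥0∞) * volume ((fun s : Plane => s k) '' A) :=
    hausdorffMeasure_le_of_le_dist fun P hP Q hQ => by
      rw [dist_eq_norm, Real.dist_eq]; exact h P hP Q hQ
  have h2 : volume ((fun s : Plane => s k) '' A) ≤ ENNReal.ofReal w := by
    refine (Real.volume_le_diam _).trans (Metric.ediam_le ?_)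
    rintro _ ⟨P, hP, rfl⟩ _ ⟨Q, hQ, rfl⟩
    rw [edist_dist, Real.dist_eq]
    exact ENNReal.ofReal_le_ofReal (hw P hP Q hQ)
  rw [ENNReal.ofReal_mul (by norm_num)]
  refine h1.trans ?_
  gcongr
  simp

/-! ### Level crossings of finite sequences -/

open Classical in
/-- The indicator of the half-line of values that are at least `u`. -/
def level (u v : ℝ) : ℝ := if u ≤ v then 1 else 0

theorem level_of_le {u v : ℝ} (h : u ≤ v) : level u v = 1 := if_pos h

theorem level_of_lt {u v : ℝ} (h : v < u) : level u v = 0 := if_neg (not_le.2 h)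

-- Separates upcrossings from downcrossings; when a level set is an interval, each kind occurs at
-- most once.
open Classical in
theorem abs_level_sub_level (u v w : ℝ) :
    |level u v - level u w| = (if v < u ∧ u ≤ w then 1 else 0)
      + (if u ≤ v ∧ w < u then 1 else 0) := by
  rcases le_or_gt u v with hv | hv <;> rcases le_or_gt u w with hw | hw <;>
    simp [level, hv, hw, not_le.2, not_lt.2]

theorem sum_ite_le_one {s : Finset ℕ} {p : ℕ → Prop} [DecidablePred p]
    (h : ∀ i ∈ s, ∀ j ∈ s, p i → p j → i = j) :
    ∑ i ∈ s, (if p i then (1 : ℝ) else 0) ≤ 1 := by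
  rw [Finset.sum_boole]
  have : (s.filter p).card ≤ 1 := by
    refine Finset.card_le_one.2 fun i hi j hj => ?_
    simp only [Finset.mem_filter] at hi hj
    exact h i hi.1 j hj.1 hi.2 hj.2
  exact_mod_cast this

/-- A sequence whose upper or lower level set is an interval crosses the level at most twice. -/
theorem sum_abs_level_sub_le_two {u : ℝ} {v : ℕ → ℝ} {b n : ℕ}
    (h : (∀ i j k, b ≤ i → i ≤ j → j ≤ k → k ≤ n → u ≤ v i → u ≤ v k → u ≤ v j) ∨
      (∀ i j k, b ≤ i → i ≤ j → j ≤ k → k ≤ n → v i < u → v k < u → v j < u)) :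
    ∑ j ∈ Finset.Ico b n, |level u (v j) - level u (v (j + 1))| ≤ 2 := by
  classical
  simp only [abs_level_sub_level, Finset.sum_add_distrib]
  rw [show (2 : ℝ) = 1 + 1 by norm_num]
  have key : ∀ i ∈ Finset.Ico b n, ∀ j ∈ Finset.Ico b n, i < j →
      ¬ ((v i < u ∧ u ≤ v (i + 1)) ∧ (v j < u ∧ u ≤ v (j + 1))) ∧
      ¬ ((u ≤ v i ∧ v (i + 1) < u) ∧ (u ≤ v j ∧ v (j + 1) < u)) := by
    intro i hi j hj hij
    rw [Finset.mem_Ico] at hi hj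
    rcases h with h | h
    · constructor
      · rintro ⟨⟨h1, h2⟩, h3, h4⟩
        exact absurd (h (i + 1) j (j + 1) (by omega) (by omega) (by omega) (by omega) h2 h4)
          (not_le.2 h3)
      · rintro ⟨⟨h1, h2⟩, h3, h4⟩
        exact absurd (h i (i + 1) j (by omega) (by omega) (by omega) (by omega) h1 h3)
          (not_le.2 h2)
    · constructor
      · rintro ⟨⟨h1, h2⟩, h3, h4⟩
        exact absurd (h i (i + 1) j (by omega) (by omega) (by omega) (by omega) h1 h3)
          (not_lt.2 h2)
      · rintro ⟨⟨h1, h2⟩, h3, h4⟩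
        exact absurd (h (i + 1) j (j + 1) (by omega) (by omega) (by omega) (by omega) h2 h4)
          (not_lt.2 h3)
  refine add_le_add (sum_ite_le_one fun i hi j hj h1 h2 => ?_)
    (sum_ite_le_one fun i hi j hj h1 h2 => ?_)
  · rcases lt_trichotomy i j with hij | hij | hij
    · exact absurd ⟨h1, h2⟩ (key i hi j hj hij).1
    · exact hij
    · exact absurd ⟨h2, h1⟩ (key j hj i hi hij).1
  · rcases lt_trichotomy i j with hij | hij | hij
    · exact absurd ⟨h1, h2⟩ (key i hi j hj hij).2
    · exact hij
    · exact absurd ⟨h2, h1⟩ (key j hj i hi hij).2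

/-- A monotone sequence crosses at most once, so the crossing is detected by the end values alone.
-/
theorem sum_abs_level_sub_eq {u : ℝ} {v : ℕ → ℝ} {b n : ℕ} (hbn : b ≤ n)
    (h : MonotoneOn v (Set.Icc b n) ∨ AntitoneOn v (Set.Icc b n)) :
    ∑ j ∈ Finset.Ico b n, |level u (v j) - level u (v (j + 1))|
      = |level u (v b) - level u (v n)| := by
  induction n, hbn using Nat.le_induction with
  | base => simp
  | succ n hn ih =>
    have hsub : Set.Icc b n ⊆ Set.Icc b (n + 1) := Set.Icc_subset_Icc_right n.le_succ
    rw [Finset.sum_Ico_succ_top hn, ih (h.imp (·.mono hsub) (·.mono hsub))]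
    have m1 : b ∈ Set.Icc b (n + 1) := ⟨le_rfl, by omega⟩
    have m2 : n ∈ Set.Icc b (n + 1) := ⟨hn, by omega⟩
    have m3 : n + 1 ∈ Set.Icc b (n + 1) := ⟨by omega, le_rfl⟩
    have ord : (v b ≤ v n ∧ v n ≤ v (n + 1)) ∨ (v n ≤ v b ∧ v (n + 1) ≤ v n) :=
      h.imp (fun h => ⟨h m1 m2 hn, h m2 m3 n.le_succ⟩) fun h => ⟨h m1 m2 hn, h m2 m3 n.le_succ⟩
    rcases le_or_gt u (v b) with h1 | h1 <;> rcases le_or_gt u (v n) with h2 | h2 <;>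
      rcases le_or_gt u (v (n + 1)) with h3 | h3 <;>
      simp [level_of_le, level_of_lt, h1, h2, h3] <;>
      rcases ord with ⟨o1, o2⟩ | ⟨o1, o2⟩ <;> linarith

/-! ### Lattice nodes, and crossings in a box of monotonicity -/

/-- The coordinate `-t + i ε` of the `i`-th row or column of the lattice. -/
def node (t ε : ℝ) (i : ℕ) : ℝ := -t + i * ε

theorem node_le_node {t ε : ℝ} (hε : 0 < ε) {i j : ℕ} : node t ε i ≤ node t ε j ↔ i ≤ j := by
  simp [node, hε]

theorem node_strictMono {t ε : ℝ} (hε : 0 < ε) : StrictMono (node t ε) :=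
  strictMono_of_le_iff_le fun _ _ => (node_le_node hε).symm

open Classical in
/-- The number of lattice nodes in an interval determines its length up to one mesh width. -/
theorem abs_card_node_sub_volume_le {t ε : ℝ} (hε : 0 < ε) {J : Set ℝ} {a n : ℕ}
    (hJ : J.OrdConnected) (hJs : J ⊆ Set.Icc (node t ε a) (node t ε n)) :
    |ε * ((Finset.Icc a n).filter fun i => node t ε i ∈ J).card - (volume J).toReal| ≤ ε := by
  set S := (Finset.Icc a n).filter fun i => node t ε i ∈ J
  have hfin : volume J ≠ ∞ := ne_top_of_le_ne_top (by simp) (measure_mono hJs)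
  -- The interval from the first to the last node in `J` lies in `J` and has at least `S.card - 1`
  -- meshes.
  have hup : ε * S.card ≤ (volume J).toReal + ε := by
    rcases S.eq_empty_or_nonempty with h0 | h0
    · rw [h0]; simp; positivity
    set i := S.min' h0
    set j := S.max' h0
    have hi : i ∈ S := S.min'_mem h0
    have hj : j ∈ S := S.max'_mem h0
    have hsub : S ⊆ Finset.Icc i j := fun k hk =>
      Finset.mem_Icc.2 ⟨S.min'_le k hk, S.le_max' k hk⟩
    have hcard : S.card + i ≤ j + 1 := by
      have := Finset.card_le_card hsub
      rw [Nat.card_Icc] at this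
      have : i ≤ j := S.min'_le j hj
      omega
    have hIJ : Set.Icc (node t ε i) (node t ε j) ⊆ J :=
      hJ.out (Finset.mem_filter.1 hi).2 (Finset.mem_filter.1 hj).2
    have hv := ENNReal.toReal_mono hfin (measure_mono hIJ)
    rw [Real.volume_Icc, ENNReal.toReal_ofReal'] at hv
    have hv := (le_max_left _ _).trans hv
    have hc : (S.card : ℝ) + i ≤ j + 1 := by exact_mod_cast hcard
    simp only [node] at hv
    nlinarith
  have hlo : (volume J).toReal ≤ ε * S.card + ε := by
    refine ENNReal.toReal_le_of_le_ofReal (by positivity) ?_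
    refine (Real.volume_le_diam J).trans (Metric.ediam_le ?_)
    -- All nodes between the first one after `p` and the last one before `q` belong to `S`.
    have key : ∀ p ∈ J, ∀ q ∈ J, p ≤ q → q - p ≤ ε * S.card + ε := by
      intro p hp q hq hpq
      set i := ⌈(p + t) / ε⌉₊
      set j := ⌊(q + t) / ε⌋₊
      have hpa := (hJs hp).1
      have hqn := (hJs hq).2
      simp only [node] at hpa hqn
      have hq0 : 0 ≤ (q + t) / ε := by
        have : 0 ≤ (a : ℝ) * ε := by positivity
        apply div_nonneg _ hε.le; linarith
      have hp0 : 0 ≤ (p + t) / ε := by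
        have : 0 ≤ (a : ℝ) * ε := by positivity
        apply div_nonneg _ hε.le; linarith
      have hi1 : (p + t) / ε ≤ i := Nat.le_ceil _
      have hi2 : (i : ℝ) < (p + t) / ε + 1 := Nat.ceil_lt_add_one hp0
      have hj1 : (j : ℝ) ≤ (q + t) / ε := Nat.floor_le hq0
      have hj2 : (q + t) / ε < j + 1 := Nat.lt_floor_add_one _
      rw [div_le_iff₀ hε] at hi1
      rw [le_div_iff₀ hε] at hj1
      rw [div_lt_iff₀ hε] at hj2
      have hi2' : i * ε < p + t + ε := by
        rw [← sub_lt_iff_lt_add, lt_div_iff₀ hε] at hi2; linarith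
      have hai : a ≤ i := by
        have : (a : ℝ) * ε ≤ i * ε := by linarith
        exact_mod_cast le_of_mul_le_mul_right this hε
      have hjn : j ≤ n := by
        have : (j : ℝ) * ε ≤ n * ε := by linarith
        exact_mod_cast le_of_mul_le_mul_right this hε
      have hsub : Finset.Icc i j ⊆ S := by
        intro k hk
        rw [Finset.mem_Icc] at hk
        have h1 : (i : ℝ) * ε ≤ k * ε := by gcongr; exact hk.1
        have h2 : (k : ℝ) * ε ≤ j * ε := by gcongr; exact hk.2
        refine Finset.mem_filter.2 ⟨Finset.mem_Icc.2 ⟨hai.trans hk.1, hk.2.trans hjn⟩, ?_⟩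
        refine hJ.out hp hq ⟨?_, ?_⟩ <;> simp only [node] <;> linarith
      have hcard := Finset.card_le_card hsub
      rw [Nat.card_Icc] at hcard
      have hc : (j : ℝ) + 1 ≤ S.card + i := by
        exact_mod_cast (by omega : j + 1 ≤ S.card + i)
      nlinarith
    intro p hp q hq
    rw [edist_dist, Real.dist_eq]
    refine ENNReal.ofReal_le_ofReal ?_
    rcases le_total p q with hpq | hpq
    · rw [abs_sub_comm, abs_of_nonneg (by linarith)]; exact key p hp q hq hpq
    · rw [abs_of_nonneg (by linarith)]; exact key q hq p hp hpq
  rw [abs_le]; constructor <;> linarith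

theorem exists_eq_of_level_ne {u lo hi : ℝ} {ψ : ℝ → ℝ} (hle : lo ≤ hi)
    (hc : ContinuousOn ψ (Set.Icc lo hi)) (h : level u (ψ lo) ≠ level u (ψ hi)) :
    ∃ y ∈ Set.Icc lo hi, ψ y = u := by
  rcases le_or_gt u (ψ lo) with h1 | h1 <;> rcases le_or_gt u (ψ hi) with h2 | h2
  · exact absurd (by rw [level_of_le h1, level_of_le h2]) h
  · exact intermediate_value_Icc' hle hc ⟨h2.le, h1⟩
  · exact intermediate_value_Icc hle hc ⟨h1.le, h2⟩
  · exact absurd (by rw [level_of_lt h1, level_of_lt h2]) h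

theorem level_ne_of_eq {u lo hi : ℝ} {ψ : ℝ → ℝ}
    (hm : StrictMonoOn ψ (Set.Icc lo hi) ∨ StrictAntiOn ψ (Set.Icc lo hi))
    {y : ℝ} (hy : y ∈ Set.Icc lo hi) (h : ψ y = u) :
    ψ lo = u ∨ ψ hi = u ∨ level u (ψ lo) ≠ level u (ψ hi) := by
  rcases hy.1.eq_or_lt with rfl | h1
  · exact Or.inl h
  rcases hy.2.eq_or_lt with rfl | h2
  · exact Or.inr (Or.inl h)
  have ml : lo ∈ Set.Icc lo hi := ⟨le_rfl, hy.1.trans hy.2⟩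
  have mh : hi ∈ Set.Icc lo hi := ⟨hy.1.trans hy.2, le_rfl⟩
  refine Or.inr (Or.inr ?_)
  rcases hm with hm | hm
  · have e1 := hm ml hy h1
    have e2 := hm hy mh h2
    rw [level_of_lt (by linarith), level_of_le (by linarith)]; norm_num
  · have e1 := hm ml hy h1
    have e2 := hm hy mh h2
    rw [level_of_le (by linarith), level_of_lt (by linarith)]; norm_num

/-- If `φ` is strictly monotone in the first variable, always in the same sense, then the
projection of its level set in a box to the first axis is an interval. -/
theorem ordConnected_proj {φ : ℝ → ℝ → ℝ} {Ix Iy : Set ℝ} {u : ℝ} (hIx : Ix.OrdConnected)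
    (hIy : Iy.OrdConnected) (hc : ∀ x ∈ Ix, ContinuousOn (φ x) Iy)
    (hx : (∀ y ∈ Iy, StrictMonoOn (fun x => φ x y) Ix) ∨
      (∀ y ∈ Iy, StrictAntiOn (fun x => φ x y) Ix)) :
    {x ∈ Ix | ∃ y ∈ Iy, φ x y = u}.OrdConnected := by
  refine ⟨?_⟩
  rintro x₁ ⟨h1, y₁, hy1, e1⟩ x₂ ⟨h2, y₂, hy2, e2⟩ x hxx
  have hxI : x ∈ Ix := hIx.out h1 h2 hxx
  rcases hxx.1.eq_or_lt with rfl | l1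
  · exact ⟨h1, y₁, hy1, e1⟩
  rcases hxx.2.eq_or_lt with rfl | l2
  · exact ⟨h2, y₂, hy2, e2⟩
  refine ⟨hxI, ?_⟩
  have hsub : Set.uIcc y₁ y₂ ⊆ Iy := hIy.uIcc_subset hy1 hy2
  have hiv := intermediate_value_uIcc ((hc x hxI).mono hsub)
  -- Moving from x₁ up to x at height y₁ and from x₂ down to x at height y₂ leaves the level on
  -- opposite sides.
  have hu : u ∈ Set.uIcc (φ x y₁) (φ x y₂) := by
    rw [Set.mem_uIcc]
    rcases hx with hx | hx
    · have a1 := hx y₁ hy1 h1 hxI l1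
      have a2 := hx y₂ hy2 hxI h2 l2
      simp only at a1 a2
      right; constructor <;> linarith
    · have a1 := hx y₁ hy1 h1 hxI l1
      have a2 := hx y₂ hy2 hxI h2 l2
      simp only at a1 a2
      left; constructor <;> linarith
  obtain ⟨y, hy, e⟩ := hiv hu
  exact ⟨y, hsub hy, e⟩

/-- The number of crossings of the level along the lines of one direction of the lattice. -/
def crossings (φ : ℝ → ℝ → ℝ) (t ε u : ℝ) (a a₁ b b₂ : ℕ) : ℝ :=
  ∑ i ∈ Finset.Ico a a₁, ∑ j ∈ Finset.Ico b b₂,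
    |level u (φ (node t ε i) (node t ε j)) - level u (φ (node t ε i) (node t ε (j + 1)))|

/-- In a box where `φ` is strictly monotone in both variables, the number of crossings along the
lines of one direction measures the projection of the level set. -/
theorem abs_crossings_sub_volume_le {φ : ℝ → ℝ → ℝ} {t ε u : ℝ} (hε : 0 < ε)
    {a a₁ a₂ b b₂ : ℕ} {Ix Iy : Set ℝ} (haa : a₂ ≤ a₁) (haa' : a₁ ≤ a₂ + 1)
    (hb : b ≤ b₂) (hIx : Ix.OrdConnected) (hIy : Iy.OrdConnected)
    (hIxs : Ix ⊆ Set.Icc (node t ε a) (node t ε a₂))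
    (hIxn : ∀ i ∈ Finset.Ico a a₁, node t ε i ∈ Ix)
    (hIys : Iy ⊆ Set.Icc (node t ε b) (node t ε b₂))
    (hIyo : Set.Ioo (node t ε b) (node t ε b₂) ⊆ Iy)
    (hc : ∀ x, Continuous (φ x))
    (hx : (∀ y ∈ Set.Icc (node t ε b) (node t ε b₂),
        StrictMonoOn (fun x => φ x y) (Set.Icc (node t ε a) (node t ε a₂))) ∨
      (∀ y ∈ Set.Icc (node t ε b) (node t ε b₂),
        StrictAntiOn (fun x => φ x y) (Set.Icc (node t ε a) (node t ε a₂))))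
    (hy : ∀ x ∈ Set.Icc (node t ε a) (node t ε a₂),
      StrictMonoOn (φ x) (Set.Icc (node t ε b) (node t ε b₂)) ∨
        StrictAntiOn (φ x) (Set.Icc (node t ε b) (node t ε b₂))) :
    |ε * crossings φ t ε u a a₁ b b₂ - (volume {x ∈ Ix | ∃ y ∈ Iy, φ x y = u}).toReal|
      ≤ 4 * ε := by
  classical
  set J := {x ∈ Ix | ∃ y ∈ Iy, φ x y = u}
  have hJo : J.OrdConnected := ordConnected_proj hIx hIy (fun x _ => (hc x).continuousOn)
    (hx.imp (fun h y hy => (h y (hIys hy)).mono hIxs) fun h y hy => (h y (hIys hy)).mono hIxs)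
  have hlohi : node t ε b ≤ node t ε b₂ := (node_le_node hε).2 hb
  set lo := node t ε b
  set hi := node t ε b₂
  set S := (Finset.Icc a a₂).filter fun i => node t ε i ∈ J
  set R := (Finset.Ico a a₁).filter fun i =>
    level u (φ (node t ε i) lo) ≠ level u (φ (node t ε i) hi)
  have hJ1 : |ε * S.card - (volume J).toReal| ≤ ε := by
    convert abs_card_node_sub_volume_le hε hJo ((Set.sep_subset _ _).trans hIxs)
  have hnode : ∀ i ∈ Finset.Ico a a₁, node t ε i ∈ Set.Icc (node t ε a) (node t ε a₂) :=
    fun i hi => hIxs (hIxn i hi)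
  have hR : crossings φ t ε u a a₁ b b₂ = R.card := by
    rw [Finset.card_filter, Nat.cast_sum, crossings]
    refine Finset.sum_congr rfl fun i hi' => ?_
    rw [sum_abs_level_sub_eq hb (v := fun j => φ (node t ε i) (node t ε j))]
    · rcases le_or_gt u (φ (node t ε i) lo) with h1 | h1 <;>
        rcases le_or_gt u (φ (node t ε i) hi) with h2 | h2 <;>
        simp [level_of_le, level_of_lt, lo, hi, h1, h2]
    · have maps : ∀ j ∈ Set.Icc b b₂, node t ε j ∈ Set.Icc lo hi := fun j hj =>
        ⟨(node_le_node hε).2 hj.1, (node_le_node hε).2 hj.2⟩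
      refine (hy _ (hnode i hi')).imp (fun h => ?_) fun h => ?_
      · intro p hp q hq hpq
        exact h.monotoneOn (maps p hp) (maps q hq) ((node_le_node hε).2 hpq)
      · intro p hp q hq hpq
        exact h.antitoneOn (maps p hp) (maps q hq) ((node_le_node hε).2 hpq)
  have hend : ∀ y ∈ Set.Icc lo hi,
      ((Finset.Icc a a₂).filter fun i => φ (node t ε i) y = u).card ≤ 1 := by
    intro y hy'
    refine Finset.card_le_one.2 fun i hi' j hj' => ?_
    simp only [Finset.mem_filter, Finset.mem_Icc] at hi' hj'
    have mi : node t ε i ∈ Set.Icc (node t ε a) (node t ε a₂) :=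
      ⟨(node_le_node hε).2 hi'.1.1, (node_le_node hε).2 hi'.1.2⟩
    have mj : node t ε j ∈ Set.Icc (node t ε a) (node t ε a₂) :=
      ⟨(node_le_node hε).2 hj'.1.1, (node_le_node hε).2 hj'.1.2⟩
    refine (node_strictMono (t := t) hε).injective ?_
    rcases hx with hx | hx
    · exact (hx y hy').injOn mi mj (hi'.2.trans hj'.2.symm)
    · exact (hx y hy').injOn mi mj (hi'.2.trans hj'.2.symm)
  -- Lines that attain the level exactly at an end of their segment are counted unreliably by
  -- `level`; strict monotonicity in the first variable allows one such line per end.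
  set E₁ := (Finset.Icc a a₂).filter fun i => φ (node t ε i) lo = u
  set E₂ := (Finset.Icc a a₂).filter fun i => φ (node t ε i) hi = u
  have hE1 : E₁.card ≤ 1 := hend lo ⟨le_rfl, hlohi⟩
  have hE2 : E₂.card ≤ 1 := hend hi ⟨hlohi, le_rfl⟩
  have hmem : ∀ i ∈ Finset.Ico a a₁, i ∈ Finset.Icc a a₂ := fun i hi' => by
    rw [Finset.mem_Icc]
    exact ⟨(Finset.mem_Ico.1 hi').1, (node_le_node hε).1 (hnode i hi').2⟩
  have h1 : R ⊆ S ∪ (E₁ ∪ E₂) := by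
    intro i hi'
    obtain ⟨him, hne⟩ := Finset.mem_filter.1 hi'
    obtain ⟨y, hy1, hy2⟩ := exists_eq_of_level_ne hlohi (hc _).continuousOn hne
    simp only [Finset.mem_union, S, E₁, E₂, Finset.mem_filter]
    rcases hy1.1.eq_or_lt with rfl | l1
    · exact Or.inr (Or.inl ⟨hmem i him, hy2⟩)
    rcases hy1.2.eq_or_lt with rfl | l2
    · exact Or.inr (Or.inr ⟨hmem i him, hy2⟩)
    exact Or.inl ⟨hmem i him, hIxn i him, y, hIyo ⟨l1, l2⟩, hy2⟩
  have h2 : S ⊆ R ∪ ((E₁ ∪ E₂) ∪ {a₂}) := by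
    intro i hi'
    obtain ⟨him, hiI, y, hyI, hyu⟩ := Finset.mem_filter.1 hi'
    simp only [Finset.mem_union, R, E₁, E₂, Finset.mem_filter, Finset.mem_singleton]
    -- The line `a₂` is counted in this block only when `a₁ = a₂ + 1`; otherwise it belongs to the
    -- next block.
    by_cases hia : i = a₂
    · exact Or.inr (Or.inr hia)
    rcases level_ne_of_eq (hy _ (hIxs hiI)) (hIys hyI) hyu with h | h | h
    · exact Or.inr (Or.inl (Or.inl ⟨him, h⟩))
    · exact Or.inr (Or.inl (Or.inr ⟨him, h⟩))
    · rw [Finset.mem_Icc] at him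
      exact Or.inl ⟨Finset.mem_Ico.2 ⟨him.1, by omega⟩, h⟩
  have c0 := Finset.card_union_le E₁ E₂
  have c1 := (Finset.card_le_card h1).trans (Finset.card_union_le _ _)
  have c2 := (Finset.card_le_card h2).trans (Finset.card_union_le _ _)
  have c3 := Finset.card_union_le (E₁ ∪ E₂) {a₂}
  rw [Finset.card_singleton] at c3
  -- At most three exceptional lines, from `E₁`, `E₂` and `a₂`; with the one mesh lost in `hJ1` this
  -- makes 4ε.
  have d1 : (R.card : ℝ) ≤ S.card + 3 := by exact_mod_cast (by omega : R.card ≤ S.card + 3)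
  have d2 : (S.card : ℝ) ≤ R.card + 3 := by exact_mod_cast (by omega : S.card ≤ R.card + 3)
  rw [hR]
  have d1' : ε * R.card ≤ ε * S.card + 3 * ε := by nlinarith
  have d2' : ε * S.card ≤ ε * R.card + 3 * ε := by nlinarith
  rw [abs_le] at hJ1 ⊢
  constructor <;> linarith [hJ1.1, hJ1.2]

/-! ### Coordinates, blocks and block counts -/

/-- The point with coordinate `k` equal to `x` and the other coordinate equal to `y`. -/
def axisPoint (k : Fin 2) (x y : ℝ) : Plane :=
  x • EuclideanSpace.single k 1 + y • EuclideanSpace.single (k + 1) 1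

theorem forall_fin_two_iff (k : Fin 2) {p : Fin 2 → Prop} : (∀ l, p l) ↔ p k ∧ p (k + 1) := by
  refine ⟨fun h => ⟨h k, h (k + 1)⟩, fun h l => ?_⟩
  by_cases hl : l = k
  · exact hl ▸ h.1
  · have : l = k + 1 := by fin_cases k <;> fin_cases l <;> first | rfl | exact absurd rfl hl
    exact this ▸ h.2

@[simp] theorem axisPoint_self (k : Fin 2) (x y : ℝ) : axisPoint k x y k = x := by
  simp [axisPoint]

@[simp] theorem axisPoint_other (k : Fin 2) (x y : ℝ) : axisPoint k x y (k + 1) = y := by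
  simp [axisPoint]

theorem axisPoint_eta (k : Fin 2) (s : Plane) : axisPoint k (s k) (s (k + 1)) = s := by
  ext l
  revert l
  rw [forall_fin_two_iff k]
  simp

theorem axisPoint_zero (x y : ℝ) : axisPoint 0 x y = !₂[x, y] := by
  have := axisPoint_eta 0 !₂[x, y]
  exact this

theorem axisPoint_one (x y : ℝ) : axisPoint 1 y x = !₂[x, y] := by
  have := axisPoint_eta 1 !₂[x, y]
  exact this

theorem continuous_axisPoint (k : Fin 2) (x : ℝ) : Continuous (axisPoint k x) := by
  unfold axisPoint; fun_prop

theorem hasDerivAt_comp_axisPoint {g : Plane → ℝ} {k : Fin 2} {x y : ℝ}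
    (hg : DifferentiableAt ℝ g (axisPoint k x y)) :
    HasDerivAt (fun y => g (axisPoint k x y)) (partialDeriv (k + 1) g (axisPoint k x y)) y := by
  have h : HasDerivAt (axisPoint k x) (EuclideanSpace.single (k + 1) 1) y := by
    have := ((hasDerivAt_id y).smul_const (EuclideanSpace.single (k + 1) (1 : ℝ))).const_add
      (x • EuclideanSpace.single k (1 : ℝ))
    simp only [id_eq, one_smul] at this
    exact this
  exact hg.hasFDerivAt.comp_hasDerivAt y h

/-- The points of the square at the level `u`. -/
def levelSet (f : Plane → ℝ) (t u : ℝ) : Set Plane := {s ∈ square t | f s = u}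

/-- The half-open range of a coordinate in a block. -/
def blockRange (t ε : ℝ) (m a : ℕ) : Set ℝ :=
  Set.Icc (-t) t ∩ Set.Ico (node t ε a) (node t ε (a + m))

/-- The half-open block of the square with lower corner of index `c`. -/
def block (t ε : ℝ) (m : ℕ) (c : Fin 2 → ℕ) : Set Plane :=
  {s | ∀ k, s k ∈ blockRange t ε m (c k)}

/-- The closed block with lower corner of index `c`, cut off at the index `N`. -/
def closedBlock (t ε : ℝ) (m N : ℕ) (c : Fin 2 → ℕ) : Set Plane :=
  {s | ∀ k, s k ∈ Set.Icc (node t ε (c k)) (node t ε (min (c k + m) N))}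

/-- The number of crossings in a block along the lines that are orthogonal to the axis `k`. -/
def blockCount (f : Plane → ℝ) (t ε u : ℝ) (m N : ℕ) (c : Fin 2 → ℕ) (k : Fin 2) : ℝ :=
  crossings (fun x y => f (axisPoint k x y)) t ε u (c k) (min (c k + m) (N + 1))
    (c (k + 1)) (min (c (k + 1) + m) N)

theorem zeta_eq (f : Plane → ℝ) (t ε u : ℝ) (i j : ℕ) :
    zeta f t ε u i j = level u (f !₂[node t ε i, node t ε j]) := by
  rw [zeta, level]
  by_cases h : u ≤ f !₂[node t ε i, node t ε j]
  · rw [if_pos h, Set.indicator_of_mem]; exact h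
  · rw [if_neg h, Set.indicator_of_notMem]; exact h

/-- The count N_h runs along lines of fixed first coordinate, so it is the one that measures the
projection to axis 0. -/
theorem countH_eq {f : Plane → ℝ} {t ε u : ℝ} {m N : ℕ} (hN : gridSize t ε = N + 1) (a b : ℕ) :
    countH f t ε u m a b = blockCount f t ε u m N ![a, b] 0 := by
  simp [countH, blockCount, crossings, zeta_eq, axisPoint_zero, hN]

theorem countV_eq {f : Plane → ℝ} {t ε u : ℝ} {m N : ℕ} (hN : gridSize t ε = N + 1) (a b : ℕ) :
    countV f t ε u m a b = blockCount f t ε u m N ![a, b] 1 := by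
  rw [countV, Finset.sum_comm]
  simp [blockCount, crossings, zeta_eq, axisPoint_one, hN]

section Grid

variable {t ε : ℝ} {m N : ℕ}

theorem node_of_mul_eq (hN : N * ε = 2 * t) : node t ε N = t := by
  rw [node, hN]; ring

theorem closedBlock_subset_square (hε : 0 < ε) (hN : N * ε = 2 * t) (c : Fin 2 → ℕ) :
    closedBlock t ε m N c ⊆ square t := by
  intro s hs k
  refine ⟨le_trans ?_ (hs k).1, (hs k).2.trans ?_⟩
  · rw [node]
    have : 0 ≤ (c k : ℝ) * ε := by positivity
    linarith
  · exact ((node_le_node hε).2 (min_le_right _ _)).trans_eq (node_of_mul_eq hN)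

theorem blockRange_subset (hε : 0 < ε) (hN : N * ε = 2 * t) (a : ℕ) :
    blockRange t ε m a ⊆ Set.Icc (node t ε a) (node t ε (min (a + m) N)) := by
  intro x hx
  refine ⟨hx.2.1, ?_⟩
  rw [(node_strictMono hε).monotone.map_min, le_min_iff, node_of_mul_eq hN]
  exact ⟨hx.2.2.le, hx.1.2⟩

theorem Ioo_subset_blockRange (hε : 0 < ε) (hN : N * ε = 2 * t) (a : ℕ) :
    Set.Ioo (node t ε a) (node t ε (min (a + m) N)) ⊆ blockRange t ε m a := by
  intro x hx
  have h2 := hx.2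
  rw [(node_strictMono hε).monotone.map_min, lt_min_iff, node_of_mul_eq hN] at h2
  have h1 : -t ≤ node t ε a := by
    rw [node]
    have : 0 ≤ (a : ℝ) * ε := by positivity
    linarith
  exact ⟨⟨h1.trans hx.1.le, h2.2.le⟩, hx.1.le, h2.1⟩

theorem node_mem_blockRange (hε : 0 < ε) (hN : N * ε = 2 * t) {a i : ℕ}
    (hi : i ∈ Finset.Ico a (min (a + m) (N + 1))) : node t ε i ∈ blockRange t ε m a := by
  rw [Finset.mem_Ico, lt_min_iff] at hi
  refine ⟨⟨?_, ?_⟩, (node_le_node hε).2 hi.1, node_strictMono hε hi.2.1⟩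
  · rw [node]
    have : 0 ≤ (i : ℝ) * ε := by positivity
    linarith
  · exact ((node_le_node hε).2 (by omega)).trans_eq (node_of_mul_eq hN)

theorem block_subset_closedBlock (hε : 0 < ε) (hN : N * ε = 2 * t) (c : Fin 2 → ℕ) :
    block t ε m c ⊆ closedBlock t ε m N c :=
  fun _ hs k => blockRange_subset hε hN _ (hs k)

theorem ordConnected_blockRange (a : ℕ) : (blockRange t ε m a).OrdConnected :=
  Set.ordConnected_Icc.inter Set.ordConnected_Ico

theorem convex_box (I : Fin 2 → Set ℝ) (hI : ∀ k, Convex ℝ (I k)) :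
    Convex ℝ {s : Plane | ∀ k, s k ∈ I k} := by
  intro x hx y hy a b ha hb hab k
  exact hI k (hx k) (hy k) ha hb hab

theorem convex_closedBlock (c : Fin 2 → ℕ) : Convex ℝ (closedBlock t ε m N c) :=
  convex_box _ fun _ => convex_Icc _ _

theorem convex_square : Convex ℝ (square t) := convex_box _ fun _ => convex_Icc _ _

theorem axisPoint_mem_closedBlock {c : Fin 2 → ℕ} {k : Fin 2} {x y : ℝ} :
    axisPoint k x y ∈ closedBlock t ε m N c ↔
      x ∈ Set.Icc (node t ε (c k)) (node t ε (min (c k + m) N)) ∧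
      y ∈ Set.Icc (node t ε (c (k + 1))) (node t ε (min (c (k + 1) + m) N)) := by
  rw [closedBlock, Set.mem_ofPred_eq, forall_fin_two_iff k]
  simp

theorem abs_coord_sub_le_of_mem_closedBlock (hε : 0 < ε) {c : Fin 2 → ℕ} {P Q : Plane}
    (hP : P ∈ closedBlock t ε m N c) (hQ : Q ∈ closedBlock t ε m N c) (k : Fin 2) :
    |P k - Q k| ≤ m * ε := by
  have h : node t ε (min (c k + m) N) ≤ node t ε (c k) + m * ε := by
    refine ((node_le_node hε).2 (min_le_left _ _)).trans ?_
    simp only [node]; push_cast; linarith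
  have h1 := hP k
  have h2 := hQ k
  rw [abs_le]
  constructor <;> linarith [h1.1, h1.2, h2.1, h2.2]

theorem image_levelSet_inter_block {f : Plane → ℝ} {u : ℝ} (c : Fin 2 → ℕ) (k : Fin 2) :
    (fun s : Plane => s k) '' (levelSet f t u ∩ block t ε m c) =
      {x ∈ blockRange t ε m (c k) |
        ∃ y ∈ blockRange t ε m (c (k + 1)), f (axisPoint k x y) = u} := by
  ext x
  constructor
  · rintro ⟨s, ⟨hs, hb⟩, rfl⟩
    exact ⟨hb k, s (k + 1), hb _, by rw [axisPoint_eta]; exact hs.2⟩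
  · rintro ⟨hx, y, hy, h⟩
    refine ⟨axisPoint k x y, ⟨⟨?_, h⟩, ?_⟩, axisPoint_self k x y⟩
    · rw [square, Set.mem_ofPred_eq, forall_fin_two_iff k, axisPoint_self, axisPoint_other]
      exact ⟨hx.1, hy.1⟩
    · rw [block, Set.mem_ofPred_eq, forall_fin_two_iff k, axisPoint_self, axisPoint_other]
      exact ⟨hx, hy⟩

end Grid

/-! ### Crossings in a block under control of the derivatives -/

theorem abs_sub_sub_le {f : Plane → ℝ} (hf : Differentiable ℝ f) {C : Set Plane}
    (hC : Convex ℝ C) {ℓ : Plane →L[ℝ] ℝ} {η : ℝ} (h : ∀ s ∈ C, ‖fderiv ℝ f s - ℓ‖ ≤ η)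
    {P Q : Plane} (hP : P ∈ C) (hQ : Q ∈ C) : |f P - f Q - ℓ (P - Q)| ≤ η * ‖P - Q‖ :=
  hC.norm_image_sub_le_of_norm_fderiv_le' (fun x _ => hf x) h hQ hP

/-- By the mean value inequality for f − ℓ, a component of ℓ larger than η decides the sign of the
increment along its axis. -/
theorem lt_of_axis_step {f : Plane → ℝ} (hf : Differentiable ℝ f) {C : Set Plane}
    (hC : Convex ℝ C) {ℓ : Plane →L[ℝ] ℝ} {η : ℝ} (h : ∀ s ∈ C, ‖fderiv ℝ f s - ℓ‖ ≤ η)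
    {P Q : Plane} (hP : P ∈ C) (hQ : Q ∈ C) {k : Fin 2} {d : ℝ} (hd : 0 < d)
    (hPQ : P - Q = d • EuclideanSpace.single k 1) :
    (η < ℓ (EuclideanSpace.single k 1) → f Q < f P) ∧
      (η < -ℓ (EuclideanSpace.single k 1) → f P < f Q) := by
  have := abs_le.1 (abs_sub_sub_le hf hC h hP hQ)
  rw [hPQ, norm_smul, map_smul] at this
  simp only [PiLp.norm_single, norm_one, mul_one, Real.norm_eq_abs, abs_of_pos hd,
    smul_eq_mul] at this
  constructor <;> intro h' <;> nlinarith [this.1, this.2]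

section Block

variable {f : Plane → ℝ} {t ε u : ℝ} {m N : ℕ} {c : Fin 2 → ℕ} {ℓ : Plane →L[ℝ] ℝ} {η : ℝ}

theorem axisPoint_sub_left (k : Fin 2) (x x' y : ℝ) :
    axisPoint k x y - axisPoint k x' y = (x - x') • EuclideanSpace.single k 1 := by
  rw [axisPoint, axisPoint, sub_smul]; abel

theorem axisPoint_sub_right (k : Fin 2) (x y y' : ℝ) :
    axisPoint k x y - axisPoint k x y' = (y - y') • EuclideanSpace.single (k + 1) 1 := by
  rw [axisPoint, axisPoint, sub_smul]; abel

theorem strictMonoOn_or_strictAntiOn_left (hf : Differentiable ℝ f)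
    (h : ∀ s ∈ closedBlock t ε m N c, ‖fderiv ℝ f s - ℓ‖ ≤ η) (k : Fin 2)
    (hk : η < |ℓ (EuclideanSpace.single k 1)|) :
    (∀ y ∈ Set.Icc (node t ε (c (k + 1))) (node t ε (min (c (k + 1) + m) N)),
        StrictMonoOn (fun x => f (axisPoint k x y))
          (Set.Icc (node t ε (c k)) (node t ε (min (c k + m) N)))) ∨
      (∀ y ∈ Set.Icc (node t ε (c (k + 1))) (node t ε (min (c (k + 1) + m) N)),
        StrictAntiOn (fun x => f (axisPoint k x y))
          (Set.Icc (node t ε (c k)) (node t ε (min (c k + m) N)))) := by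
  rcases lt_abs.1 hk with hk | hk
  · refine Or.inl fun y hy x hx x' hx' hxx => ?_
    exact (lt_of_axis_step hf (convex_closedBlock c) h (axisPoint_mem_closedBlock.2 ⟨hx', hy⟩)
      (axisPoint_mem_closedBlock.2 ⟨hx, hy⟩) (sub_pos.2 hxx) (axisPoint_sub_left k x' x y)).1 hk
  · refine Or.inr fun y hy x hx x' hx' hxx => ?_
    exact (lt_of_axis_step hf (convex_closedBlock c) h (axisPoint_mem_closedBlock.2 ⟨hx', hy⟩)
      (axisPoint_mem_closedBlock.2 ⟨hx, hy⟩) (sub_pos.2 hxx) (axisPoint_sub_left k x' x y)).2 hk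

theorem strictMonoOn_or_strictAntiOn_right (hf : Differentiable ℝ f)
    (h : ∀ s ∈ closedBlock t ε m N c, ‖fderiv ℝ f s - ℓ‖ ≤ η) (k : Fin 2)
    (hk : η < |ℓ (EuclideanSpace.single (k + 1) 1)|) {x : ℝ}
    (hx : x ∈ Set.Icc (node t ε (c k)) (node t ε (min (c k + m) N))) :
    StrictMonoOn (fun y => f (axisPoint k x y))
        (Set.Icc (node t ε (c (k + 1))) (node t ε (min (c (k + 1) + m) N))) ∨
      StrictAntiOn (fun y => f (axisPoint k x y))
        (Set.Icc (node t ε (c (k + 1))) (node t ε (min (c (k + 1) + m) N))) := by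
  rcases lt_abs.1 hk with hk | hk
  · refine Or.inl fun y hy y' hy' hyy => ?_
    exact (lt_of_axis_step hf (convex_closedBlock c) h (axisPoint_mem_closedBlock.2 ⟨hx, hy'⟩)
      (axisPoint_mem_closedBlock.2 ⟨hx, hy⟩) (sub_pos.2 hyy) (axisPoint_sub_right k x y' y)).1 hk
  · refine Or.inr fun y hy y' hy' hyy => ?_
    exact (lt_of_axis_step hf (convex_closedBlock c) h (axisPoint_mem_closedBlock.2 ⟨hx, hy'⟩)
      (axisPoint_mem_closedBlock.2 ⟨hx, hy⟩) (sub_pos.2 hyy) (axisPoint_sub_right k x y' y)).2 hk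

/-- In a block where no partial derivative changes its sign, the counts measure the projections
of the level set. -/
theorem abs_blockCount_sub_volume_le (hf : Differentiable ℝ f) (hε : 0 < ε)
    (hN : N * ε = 2 * t) (hc : ∀ k, c k ≤ N)
    (h : ∀ s ∈ closedBlock t ε m N c, ‖fderiv ℝ f s - ℓ‖ ≤ η)
    (hk : ∀ k, η < |ℓ (EuclideanSpace.single k 1)|) (k : Fin 2) :
    |ε * blockCount f t ε u m N c k
      - (volume ((fun s : Plane => s k) '' (levelSet f t u ∩ block t ε m c))).toReal| ≤ 4 * ε := by
  rw [image_levelSet_inter_block]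
  refine abs_crossings_sub_volume_le (φ := fun x y => f (axisPoint k x y)) hε
    (a₂ := min (c k + m) N) (by omega) (by omega)
    (by have := hc (k + 1); omega) (ordConnected_blockRange _) (ordConnected_blockRange _)
    (blockRange_subset hε hN _) (fun i hi => node_mem_blockRange hε hN hi)
    (blockRange_subset hε hN _) (Ioo_subset_blockRange hε hN _)
    (fun x => hf.continuous.comp (continuous_axisPoint k x))
    (strictMonoOn_or_strictAntiOn_left hf h k (hk k))
    (fun x hx => strictMonoOn_or_strictAntiOn_right hf h k (hk _) hx)

/-- The strict sublevel set of a quasiconvex function, or the superlevel set of a quasiconcave one,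
is an interval. -/
theorem sum_abs_level_sub_le_two_of_quasiconvexOn {ψ : ℝ → ℝ} (hε : 0 < ε) {b n : ℕ}
    (hψ : QuasiconvexOn ℝ (Set.Icc (node t ε b) (node t ε n)) ψ ∨
      QuasiconcaveOn ℝ (Set.Icc (node t ε b) (node t ε n)) ψ) :
    ∑ j ∈ Finset.Ico b n, |level u (ψ (node t ε j)) - level u (ψ (node t ε (j + 1)))| ≤ 2 := by
  refine sum_abs_level_sub_le_two (v := fun j => ψ (node t ε j)) ?_
  have mem : ∀ j, b ≤ j → j ≤ n → node t ε j ∈ Set.Icc (node t ε b) (node t ε n) := fun j h1 h2 =>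
    ⟨(node_le_node hε).2 h1, (node_le_node hε).2 h2⟩
  rcases hψ with hψ | hψ
  · refine Or.inr fun i j k hi hij hjk hk h1 h2 => ?_
    have := (hψ.convex_lt u).ordConnected
    exact (this.out ⟨mem i hi (by omega), h1⟩ ⟨mem k (by omega) hk, h2⟩
      ⟨(node_le_node hε).2 hij, (node_le_node hε).2 hjk⟩).2
  · refine Or.inl fun i j k hi hij hjk hk h1 h2 => ?_
    have := (hψ u).ordConnected
    exact (this.out ⟨mem i hi (by omega), h1⟩ ⟨mem k (by omega) hk, h2⟩
      ⟨(node_le_node hε).2 hij, (node_le_node hε).2 hjk⟩).2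

/-- Each alternative controls `f` along the lines in direction `k + 1`: a first derivative of fixed
sign gives monotonicity, a second derivative of fixed sign convexity or concavity. -/
theorem quasiconvexOn_or_quasiconcaveOn (hf : ContDiff ℝ 2 f) {k : Fin 2} {x : ℝ}
    (hx : x ∈ Set.Icc (node t ε (c k)) (node t ε (min (c k + m) N)))
    (h : ((∀ s ∈ closedBlock t ε m N c, ‖fderiv ℝ f s - ℓ‖ ≤ η) ∧
        η < |ℓ (EuclideanSpace.single (k + 1) 1)|) ∨
      (∀ s ∈ closedBlock t ε m N c, 0 ≤ partialDeriv (k + 1) (partialDeriv (k + 1) f) s) ∨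
      (∀ s ∈ closedBlock t ε m N c, partialDeriv (k + 1) (partialDeriv (k + 1) f) s ≤ 0)) :
    QuasiconvexOn ℝ (Set.Icc (node t ε (c (k + 1))) (node t ε (min (c (k + 1) + m) N)))
        (fun y => f (axisPoint k x y)) ∨
      QuasiconcaveOn ℝ (Set.Icc (node t ε (c (k + 1))) (node t ε (min (c (k + 1) + m) N)))
        (fun y => f (axisPoint k x y)) := by
  have hfd : Differentiable ℝ f := hf.differentiable (by norm_num)
  have hpd : Differentiable ℝ (partialDeriv (k + 1) f) := by
    have h1 : ContDiff ℝ 1 (fderiv ℝ f) := hf.fderiv_right (by norm_num)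
    exact (h1.differentiable (by norm_num)).clm_apply (differentiable_const _)
  have hcont : ContinuousOn (fun y => f (axisPoint k x y))
      (Set.Icc (node t ε (c (k + 1))) (node t ε (min (c (k + 1) + m) N))) :=
    (hf.continuous.comp (continuous_axisPoint k x)).continuousOn
  rcases h with ⟨h, hk⟩ | h | h
  · rcases strictMonoOn_or_strictAntiOn_right hfd h k hk hx with hm | hm
    · exact Or.inl (hm.monotoneOn.quasiconvexOn (convex_Icc _ _))
    · exact Or.inl (hm.antitoneOn.quasiconvexOn (convex_Icc _ _))
  · refine Or.inl (ConvexOn.quasiconvexOn ?_)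
    refine convexOn_of_hasDerivWithinAt2_nonneg (convex_Icc _ _) hcont
      (fun y _ => (hasDerivAt_comp_axisPoint (hfd _)).hasDerivWithinAt)
      (fun y _ => (hasDerivAt_comp_axisPoint (hpd _)).hasDerivWithinAt)
      (fun y hy => h _ (axisPoint_mem_closedBlock.2 ⟨hx, interior_subset hy⟩))
  · refine Or.inr (ConcaveOn.quasiconcaveOn ?_)
    refine concaveOn_of_hasDerivWithinAt2_nonpos (convex_Icc _ _) hcont
      (fun y _ => (hasDerivAt_comp_axisPoint (hfd _)).hasDerivWithinAt)
      (fun y _ => (hasDerivAt_comp_axisPoint (hpd _)).hasDerivWithinAt)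
      (fun y hy => h _ (axisPoint_mem_closedBlock.2 ⟨hx, interior_subset hy⟩))

/-- A line that crosses the level at most twice contributes at most two to the count. -/
theorem blockCount_le (hf : ContDiff ℝ 2 f) (hε : 0 < ε) (hN : N * ε = 2 * t) {k : Fin 2}
    (h : ((∀ s ∈ closedBlock t ε m N c, ‖fderiv ℝ f s - ℓ‖ ≤ η) ∧
        η < |ℓ (EuclideanSpace.single (k + 1) 1)|) ∨
      (∀ s ∈ closedBlock t ε m N c, 0 ≤ partialDeriv (k + 1) (partialDeriv (k + 1) f) s) ∨
      (∀ s ∈ closedBlock t ε m N c, partialDeriv (k + 1) (partialDeriv (k + 1) f) s ≤ 0)) :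
    blockCount f t ε u m N c k ≤ 2 * m := by
  rw [blockCount, crossings]
  have key : ∀ i ∈ Finset.Ico (c k) (min (c k + m) (N + 1)),
      ∑ j ∈ Finset.Ico (c (k + 1)) (min (c (k + 1) + m) N),
        |level u (f (axisPoint k (node t ε i) (node t ε j)))
          - level u (f (axisPoint k (node t ε i) (node t ε (j + 1))))| ≤ 2 := fun i hi =>
    sum_abs_level_sub_le_two_of_quasiconvexOn hε (quasiconvexOn_or_quasiconcaveOn hf
      (blockRange_subset hε hN _ (node_mem_blockRange hε hN hi)) h)
  refine (Finset.sum_le_card_nsmul _ _ _ key).trans ?_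
  rw [Nat.card_Ico, nsmul_eq_mul, mul_comm]
  have : ((min (c k + m) (N + 1) - c k : ℕ) : ℝ) ≤ m := by
    exact_mod_cast (by omega : min (c k + m) (N + 1) - c k ≤ m)
  linarith

theorem blockCount_nonneg (f : Plane → ℝ) (t ε u : ℝ) (m N : ℕ) (c : Fin 2 → ℕ) (k : Fin 2) :
    0 ≤ blockCount f t ε u m N c k := by
  rw [blockCount, crossings]
  exact Finset.sum_nonneg fun _ _ => Finset.sum_nonneg fun _ _ => abs_nonneg _

/-- A crossing between neighbouring nodes gives a point of the level set between them. The closed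
block is needed because the last step may end on its far edge. -/
theorem blockCount_eq_zero (hf : Continuous f) (hε : 0 < ε) (hN : N * ε = 2 * t)
    (h : closedBlock t ε m N c ∩ levelSet f t u = ∅) (k : Fin 2) :
    blockCount f t ε u m N c k = 0 := by
  rw [blockCount, crossings]
  refine Finset.sum_eq_zero fun i hi => Finset.sum_eq_zero fun j hj => ?_
  by_contra hne
  have hi' := blockRange_subset hε hN _ (node_mem_blockRange hε hN hi)
  obtain ⟨y, hy, hyu⟩ := exists_eq_of_level_ne (u := u)
    (ψ := fun y => f (axisPoint k (node t ε i) y)) ((node_le_node hε).2 j.le_succ)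
    (hf.comp (continuous_axisPoint k _)).continuousOn
    (fun e => hne (by rw [sub_eq_zero.2 e, abs_zero]))
  rw [Finset.mem_Ico] at hj
  have hm : axisPoint k (node t ε i) y ∈ closedBlock t ε m N c :=
    axisPoint_mem_closedBlock.2 ⟨hi', ((node_le_node hε).2 hj.1).trans hy.1,
      hy.2.trans ((node_le_node hε).2 hj.2)⟩
  have : axisPoint k (node t ε i) y ∈ closedBlock t ε m N c ∩ levelSet f t u :=
    ⟨hm, closedBlock_subset_square hε hN c hm, hyu⟩
  rw [h] at this
  exact this

end Block

/-! ### Partition of the square into blocks, and counting of blocks -/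

section Partition

variable {t ε : ℝ} {m N : ℕ}

theorem mem_blockIndices (hN : gridSize t ε = N + 1) {a : ℕ} :
    a ∈ blockIndices t ε m ↔ a ≤ N ∧ m ∣ a := by
  rw [blockIndices, Finset.mem_filter, Finset.mem_range, hN, Nat.lt_succ_iff,
    Nat.modEq_zero_iff_dvd]

/-- The lower corners of the blocks. -/
def corners (t ε : ℝ) (m : ℕ) : Finset (Fin 2 → ℕ) :=
  Fintype.piFinset fun _ => blockIndices t ε m

theorem mem_corners (hN : gridSize t ε = N + 1) {c : Fin 2 → ℕ} :
    c ∈ corners t ε m ↔ ∀ k, c k ≤ N ∧ m ∣ c k := by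
  simp [corners, mem_blockIndices hN]

theorem sum_corners (g : (Fin 2 → ℕ) → ℝ) :
    ∑ a ∈ blockIndices t ε m, ∑ b ∈ blockIndices t ε m, g ![a, b]
      = ∑ c ∈ corners t ε m, g c := by
  rw [← Finset.sum_product' _ _ fun a b => g ![a, b]]
  refine Finset.sum_nbij' (fun p => ![p.1, p.2]) (fun c => (c 0, c 1)) ?_ ?_ ?_ ?_ ?_
  · intro p hp
    rw [Finset.mem_product] at hp
    simp [corners, Fin.forall_fin_two, hp.1, hp.2]
  · intro c hc
    simp only [corners, Fintype.mem_piFinset] at hc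
    simp [hc]
  · intro p _; simp
  · intro c _; ext i; fin_cases i <;> rfl
  · intro p _; rfl

theorem measurableSet_block (c : Fin 2 → ℕ) : MeasurableSet (block t ε m c) := by
  have : block t ε m c = ⋂ k, (fun s : Plane => s k) ⁻¹' blockRange t ε m (c k) := by
    ext s; simp [block]
  rw [this]
  refine MeasurableSet.iInter fun k => ?_
  exact (measurableSet_Icc.inter measurableSet_Ico).preimage (by fun_prop)

theorem pairwiseDisjoint_block (hε : 0 < ε) (hN : gridSize t ε = N + 1) (A : Set Plane) :
    (corners t ε m : Set (Fin 2 → ℕ)).PairwiseDisjoint fun c => A ∩ block t ε m c := by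
  intro c hc d hd hcd
  refine Set.disjoint_left.2 fun s hs hs' => hcd ?_
  rw [Finset.mem_coe, mem_corners hN] at hc hd
  ext k
  have h1 := (hs.2 k).2
  have h2 := (hs'.2 k).2
  have e1 := (node_strictMono hε).lt_iff_lt.1 (h1.1.trans_lt h2.2)
  have e2 := (node_strictMono hε).lt_iff_lt.1 (h2.1.trans_lt h1.2)
  obtain ⟨p, hp⟩ := (hc k).2
  obtain ⟨q, hq⟩ := (hd k).2
  rw [hp, hq] at e1 e2 ⊢
  have f1 : p < q + 1 := lt_of_mul_lt_mul_left' (a := m) (by rw [mul_add, mul_one]; exact e1)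
  have f2 : q < p + 1 := lt_of_mul_lt_mul_left' (a := m) (by rw [mul_add, mul_one]; exact e2)
  rw [show p = q by omega]

theorem exists_mem_block (hε : 0 < ε) (hm : 0 < m) (hN : gridSize t ε = N + 1)
    (hNt : N * ε = 2 * t) {s : Plane} (hs : s ∈ square t) :
    ∃ c ∈ corners t ε m, s ∈ block t ε m c := by
  have hw : 0 < m * ε := by positivity
  refine ⟨fun k => m * ⌊(s k + t) / (m * ε)⌋₊, (mem_corners hN).2 fun k => ⟨?_, dvd_mul_right _ _⟩,
    fun k => ⟨hs k, ?_⟩⟩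
  · have h0 : 0 ≤ (s k + t) / (m * ε) := div_nonneg (by linarith [(hs k).1]) hw.le
    have h1 := Nat.floor_le h0
    rw [le_div_iff₀ hw] at h1
    have h2 := (hs k).2
    have : ((m * ⌊(s k + t) / (m * ε)⌋₊ : ℕ) : ℝ) * ε ≤ N * ε := by push_cast; linarith
    exact_mod_cast le_of_mul_le_mul_right this hε
  · have h0 : 0 ≤ (s k + t) / (m * ε) := div_nonneg (by linarith [(hs k).1]) hw.le
    have h1 := Nat.floor_le h0
    rw [le_div_iff₀ hw] at h1
    have h2 := Nat.lt_floor_add_one ((s k + t) / (m * ε))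
    rw [div_lt_iff₀ hw] at h2
    constructor <;> simp only [node] <;> push_cast <;> linarith

theorem hausdorffMeasure_eq_sum (hε : 0 < ε) (hm : 0 < m) (hN : gridSize t ε = N + 1)
    (hNt : N * ε = 2 * t) {A : Set Plane} (hA : MeasurableSet A) (hAs : A ⊆ square t) :
    μH[1] A = ∑ c ∈ corners t ε m, μH[1] (A ∩ block t ε m c) := by
  rw [← measure_biUnion_finset (pairwiseDisjoint_block hε hN A)
    fun c _ => hA.inter (measurableSet_block c)]
  congr 1
  ext s
  simp only [Set.mem_iUnion, Set.mem_inter_iff, exists_prop]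
  refine ⟨fun h => ?_, fun ⟨c, _, h, _⟩ => h⟩
  obtain ⟨c, hc, hsc⟩ := exists_mem_block hε hm hN hNt (hAs h)
  exact ⟨c, hc, h, hsc⟩

/-- Division by `m` is injective on multiples of `m` and maps the set into a window of `q + 1`
integers. -/
theorem card_le_of_dvd {S : Finset ℕ} (hm : 0 < m) {q : ℕ} (hS : ∀ a ∈ S, m ∣ a)
    (h : ∀ a ∈ S, ∀ b ∈ S, a ≤ b + q * m) : S.card ≤ q + 1 := by
  rcases S.eq_empty_or_nonempty with rfl | h0
  · simp
  have hinj : Set.InjOn (fun a => a / m) (S : Set ℕ) := fun a ha b hb hab =>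
    (Nat.div_left_inj (hS a ha) (hS b hb)).1 hab
  rw [← Finset.card_image_of_injOn hinj]
  set b := S.min' h0
  have hsub : S.image (fun a => a / m) ⊆ Finset.Icc (b / m) (b / m + q) := by
    intro x hx
    obtain ⟨a, ha, rfl⟩ := Finset.mem_image.1 hx
    rw [Finset.mem_Icc]
    refine ⟨Nat.div_le_div_right (S.min'_le a ha), ?_⟩
    rw [← Nat.add_mul_div_right _ _ hm]
    exact Nat.div_le_div_right (h a ha b (S.min'_mem h0))
  refine (Finset.card_le_card hsub).trans ?_
  rw [Nat.card_Icc]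
  omega

theorem index_sub_le_of_mem_closedBlock (hε : 0 < ε) {c d : Fin 2 → ℕ} {P Q : Plane}
    (hP : P ∈ closedBlock t ε m N c) (hQ : Q ∈ closedBlock t ε m N d) (k : Fin 2) :
    (c k : ℝ) * ε - d k * ε ≤ P k - Q k + m * ε := by
  have h1 := (hP k).1
  have h2 := (hQ k).2.trans ((node_le_node hε).2 (min_le_left _ _))
  simp only [node] at h1 h2
  push_cast at h2
  linarith

/-- Blocks that contain points of a set with a bi-Lipschitz projection to an axis are few. -/
theorem card_corners_le (hε : 0 < ε) (hm : 0 < m) {H : Finset (Fin 2 → ℕ)}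
    (hH : ∀ c ∈ H, ∀ k, m ∣ c k) {z : (Fin 2 → ℕ) → Plane}
    (hz : ∀ c ∈ H, z c ∈ closedBlock t ε m N c) {k : Fin 2} {r : ℝ} (hr : 0 ≤ r)
    (hk : ∀ c ∈ H, ∀ d ∈ H, ‖z c - z d‖ ≤ 4 * |z c k - z d k|)
    (hzr : ∀ c ∈ H, ∀ d ∈ H, |z c k - z d k| ≤ r) :
    (H.card : ℝ) ≤ 6 * (r / (m * ε) + 3) := by
  classical
  have hw : 0 < m * ε := by positivity
  -- For equal index `k`, the chosen points differ by at most mε in that coordinate, hence by at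
  -- most 4mε in norm; the other indices then differ by at most 5m, which leaves six values.
  have h1 : H.card ≤ 6 * (H.image fun c => c k).card := by
    refine Finset.card_le_mul_card_image H 6 fun b _ => ?_
    have hinj : Set.InjOn (fun c : Fin 2 → ℕ => c (k + 1))
        ((H.filter fun c => c k = b : Finset (Fin 2 → ℕ)) : Set (Fin 2 → ℕ)) := by
      intro c hc d hd hcd
      rw [Finset.mem_coe, Finset.mem_filter] at hc hd
      ext l
      revert l
      rw [forall_fin_two_iff k]
      exact ⟨hc.2.trans hd.2.symm, hcd⟩
    rw [← Finset.card_image_of_injOn hinj]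
    refine card_le_of_dvd hm (q := 5) ?_ ?_
    · intro a ha
      obtain ⟨c, hc, rfl⟩ := Finset.mem_image.1 ha
      exact hH c (Finset.mem_filter.1 hc).1 _
    · intro a ha a' ha'
      obtain ⟨c, hc, rfl⟩ := Finset.mem_image.1 ha
      obtain ⟨d, hd, rfl⟩ := Finset.mem_image.1 ha'
      rw [Finset.mem_filter] at hc hd
      have e1 := index_sub_le_of_mem_closedBlock hε (hz c hc.1) (hz d hd.1) k
      have e1' := index_sub_le_of_mem_closedBlock hε (hz d hd.1) (hz c hc.1) k
      have e2 := index_sub_le_of_mem_closedBlock hε (hz c hc.1) (hz d hd.1) (k + 1)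
      rw [hc.2, hd.2] at e1 e1'
      have e3 := hk c hc.1 d hd.1
      have e4 : |z c k - z d k| ≤ m * ε := by rw [abs_le]; constructor <;> linarith
      have e5 : z c (k + 1) - z d (k + 1) ≤ ‖z c - z d‖ :=
        (le_abs_self _).trans (abs_coord_le_norm (z c - z d) (k + 1))
      have : (c (k + 1) : ℝ) * ε ≤ (d (k + 1) + 5 * m : ℕ) * ε := by push_cast; linarith
      exact_mod_cast le_of_mul_le_mul_right this hε
  -- Indices in direction `k` differ by at most r/ε + m, since a point may lie anywhere in its
  -- block.
  have h2 : (H.image fun c => c k).card ≤ ⌈r / (m * ε)⌉₊ + 1 + 1 := by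
    refine card_le_of_dvd hm ?_ ?_
    · intro a ha
      obtain ⟨c, hc, rfl⟩ := Finset.mem_image.1 ha
      exact hH c hc _
    · intro a ha a' ha'
      obtain ⟨c, hc, rfl⟩ := Finset.mem_image.1 ha
      obtain ⟨d, hd, rfl⟩ := Finset.mem_image.1 ha'
      have e1 := index_sub_le_of_mem_closedBlock hε (hz c hc) (hz d hd) k
      have e2 := (le_abs_self _).trans (hzr c hc d hd)
      have e3 := Nat.le_ceil (r / (m * ε))
      rw [div_le_iff₀ hw] at e3
      have : (c k : ℝ) * ε ≤ (d k + (⌈r / (m * ε)⌉₊ + 1) * m : ℕ) * ε := by push_cast; linarith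
      exact_mod_cast le_of_mul_le_mul_right this hε
  have h3 := Nat.ceil_lt_add_one (show 0 ≤ r / (m * ε) by positivity)
  have h4 : (H.card : ℝ) ≤ 6 * ((⌈r / (m * ε)⌉₊ : ℝ) + 1 + 1) := by
    exact_mod_cast h1.trans (Nat.mul_le_mul_left 6 h2)
  linarith

end Partition

/-! ### Error of the estimator in one block -/

section Block

variable {f : Plane → ℝ} {t ε u : ℝ} {m N : ℕ} {c : Fin 2 → ℕ} {z : Plane} {η : ℝ}

theorem abs_apply_sub_le_of_levelSet (hf : Differentiable ℝ f) {C : Set Plane}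
    (hC : Convex ℝ C) {ℓ : Plane →L[ℝ] ℝ} (h : ∀ s ∈ C, ‖fderiv ℝ f s - ℓ‖ ≤ η)
    {P Q : Plane} (hP : P ∈ C) (hQ : Q ∈ C) (hPu : f P = u) (hQu : f Q = u) :
    |ℓ (P - Q)| ≤ η * ‖P - Q‖ := by
  have := abs_sub_sub_le hf hC h hP hQ
  rwa [hPu, hQu, sub_self, zero_sub, abs_neg] at this

theorem hausdorffMeasure_block_le (hf : Differentiable ℝ f) (hε : 0 < ε) (hN : N * ε = 2 * t)
    (hη : 0 ≤ η) (hg : 0 < gradNorm (fderiv ℝ f z)) (hηg : 8 * η ≤ gradNorm (fderiv ℝ f z))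
    (h : ∀ s ∈ closedBlock t ε m N c, ‖fderiv ℝ f s - fderiv ℝ f z‖ ≤ η) :
    μH[1] (levelSet f t u ∩ block t ε m c) ≤ ENNReal.ofReal (4 * (m * ε)) := by
  have hsub := block_subset_closedBlock (m := m) hε hN c
  obtain ⟨k, hk⟩ := exists_norm_sub_le_coord (A := levelSet f t u ∩ block t ε m c) hη hg hηg
    fun P hP Q hQ => abs_apply_sub_le_of_levelSet hf (convex_closedBlock c) h
      (hsub hP.2) (hsub hQ.2) hP.1.2 hQ.1.2
  exact hausdorffMeasure_le_of_coord hk fun P hP Q hQ =>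
    abs_coord_sub_le_of_mem_closedBlock hε (hsub hP.2) (hsub hQ.2) k

/-- The crude bound, valid also where a partial derivative vanishes: either the first or the second
derivative keeps its sign in the block, so each count is at most 2m. -/
theorem norm_blockCount_le (hf : ContDiff ℝ 2 f) (hε : 0 < ε) (hN : N * ε = 2 * t)
    (h : ∀ s ∈ closedBlock t ε m N c, ‖fderiv ℝ f s - fderiv ℝ f z‖ ≤ η)
    (h2 : ∀ k, ∀ s ∈ closedBlock t ε m N c,
      |partialDeriv k (partialDeriv k f) s - partialDeriv k (partialDeriv k f) z| ≤ η)
    (hk : ∀ k, η < |partialDeriv k f z| ∨ η < |partialDeriv k (partialDeriv k f) z|) :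
    ε * ‖WithLp.toLp 2 ![blockCount f t ε u m N c 0, blockCount f t ε u m N c 1]‖
      ≤ 4 * (m * ε) := by
  have key : ∀ k, |blockCount f t ε u m N c k| ≤ 2 * m := by
    intro k
    rw [abs_of_nonneg (blockCount_nonneg f t ε u m N c k)]
    refine blockCount_le (ℓ := fderiv ℝ f z) (η := η) hf hε hN ?_
    rcases hk (k + 1) with hk | hk
    · exact Or.inl ⟨h, hk⟩
    · rcases lt_abs.1 hk with hk | hk
      · exact Or.inr (Or.inl fun s hs => by linarith [(abs_le.1 (h2 (k + 1) s hs)).1])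
      · exact Or.inr (Or.inr fun s hs => by linarith [(abs_le.1 (h2 (k + 1) s hs)).2])
  have := norm_pair_le (blockCount f t ε u m N c 0) (blockCount f t ε u m N c 1)
  have h0 := key 0
  have h1 := key 1
  nlinarith

/-- The fine bound: 4ε for each projection, plus the error of replacing the curve by a segment,
whose length is at most 4mε. -/
theorem abs_norm_blockCount_sub_le (hf : Differentiable ℝ f) (hε : 0 < ε) (hN : N * ε = 2 * t)
    (hc : ∀ k, c k ≤ N) (hη : 0 ≤ η) (hg : 0 < gradNorm (fderiv ℝ f z))
    (hηg : 8 * η ≤ gradNorm (fderiv ℝ f z))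
    (h : ∀ s ∈ closedBlock t ε m N c, ‖fderiv ℝ f s - fderiv ℝ f z‖ ≤ η)
    (hk : ∀ k, η < |partialDeriv k f z|) :
    |ε * ‖WithLp.toLp 2 ![blockCount f t ε u m N c 0, blockCount f t ε u m N c 1]‖
      - (μH[1] (levelSet f t u ∩ block t ε m c)).toReal|
      ≤ 8 * ε + 4 * η / gradNorm (fderiv ℝ f z) * (4 * (m * ε)) := by
  have hsub := block_subset_closedBlock (m := m) hε hN c
  have hle := hausdorffMeasure_block_le (u := u) hf hε hN hη hg hηg h
  have hfin : μH[1] (levelSet f t u ∩ block t ε m c) ≠ ∞ :=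
    ne_top_of_le_ne_top ENNReal.ofReal_ne_top hle
  have hle' := ENNReal.toReal_le_of_le_ofReal (by positivity) hle
  have h1 := abs_norm_proj_sub_hausdorffMeasure_le (A := levelSet f t u ∩ block t ε m c) hη hg
    (fun P hP Q hQ => abs_apply_sub_le_of_levelSet hf (convex_closedBlock c) h
      (hsub hP.2) (hsub hQ.2) hP.1.2 hQ.1.2) hfin
  have h2 : 4 * η / gradNorm (fderiv ℝ f z) * (μH[1] (levelSet f t u ∩ block t ε m c)).toReal
      ≤ 4 * η / gradNorm (fderiv ℝ f z) * (4 * (m * ε)) := by gcongr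
  have h3 := abs_blockCount_sub_volume_le (u := u) hf hε hN hc h hk 0
  have h4 := abs_blockCount_sub_volume_le (u := u) hf hε hN hc h hk 1
  have h5 : ε * ‖WithLp.toLp 2 ![blockCount f t ε u m N c 0, blockCount f t ε u m N c 1]‖
      = ‖WithLp.toLp 2 ![ε * blockCount f t ε u m N c 0, ε * blockCount f t ε u m N c 1]‖ := by
    rw [norm_pair, norm_pair, mul_pow, mul_pow, ← mul_add, Real.sqrt_mul (by positivity),
      Real.sqrt_sq hε.le]
  have h6 := abs_norm_pair_sub_le (ε * blockCount f t ε u m N c 0)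
    (ε * blockCount f t ε u m N c 1)
    (volume ((fun s : Plane => s 0) '' (levelSet f t u ∩ block t ε m c))).toReal
    (volume ((fun s : Plane => s 1) '' (levelSet f t u ∩ block t ε m c))).toReal
  rw [h5]
  rw [abs_le] at h1 h6 ⊢
  constructor <;> linarith [h1.1, h1.2, h6.1, h6.2]

theorem norm_sub_le_of_mem_closedBlock (hε : 0 < ε) {P Q : Plane}
    (hP : P ∈ closedBlock t ε m N c) (hQ : Q ∈ closedBlock t ε m N c) :
    ‖P - Q‖ ≤ 2 * (m * ε) := by
  have h0 := abs_coord_sub_le_of_mem_closedBlock hε hP hQ 0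
  have h1 := abs_coord_sub_le_of_mem_closedBlock hε hP hQ 1
  have := norm_pair_le ((P - Q) 0) ((P - Q) 1)
  rw [norm_pair, ← plane_norm] at this
  exact this.trans (by simp only [PiLp.sub_apply]; linarith)

end Block

/-! ### Compactness and the level set of a nondegenerate path -/

theorem exists_pos_le_of_isCompact {K : Set Plane} (hK : IsCompact K) {h : Plane → ℝ}
    (hc : ContinuousOn h K) (hpos : ∀ x ∈ K, 0 < h x) : ∃ a > 0, ∀ x ∈ K, a ≤ h x := by
  rcases K.eq_empty_or_nonempty with rfl | hne
  · exact ⟨1, one_pos, by simp⟩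
  · obtain ⟨x, hx, hmin⟩ := hK.exists_isMinOn hne hc
    exact ⟨h x, hpos x hx, fun y hy => hmin hy⟩

theorem isClosed_square (t : ℝ) : IsClosed (square t) := by
  have : square t = ⋂ k, (fun s : Plane => s k) ⁻¹' Set.Icc (-t) t := by ext s; simp [square]
  rw [this]
  exact isClosed_iInter fun k => isClosed_Icc.preimage (by fun_prop)

theorem isCompact_square (t : ℝ) : IsCompact (square t) := by
  refine Metric.isCompact_of_isClosed_isBounded (isClosed_square t) ?_
  refine (Metric.isBounded_iff_subset_closedBall 0).2 ⟨t + t, fun s hs => ?_⟩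
  rw [mem_closedBall_zero_iff, plane_norm, ← norm_pair]
  refine (norm_pair_le _ _).trans (add_le_add ?_ ?_) <;> rw [abs_le]
  exacts [hs 0, hs 1]

section Path

variable {f : Plane → ℝ} {t u : ℝ}

theorem isCompact_levelSet (hf : Continuous f) : IsCompact (levelSet f t u) :=
  (isCompact_square t).of_isClosed_subset
    ((isClosed_square t).inter (isClosed_singleton.preimage hf)) (Set.sep_subset _ _)

theorem contDiff_partialDeriv (hf : ContDiff ℝ 2 f) (k : Fin 2) :
    ContDiff ℝ 1 (partialDeriv k f) :=
  (hf.fderiv_right (m := 1) (by norm_num)).clm_apply contDiff_const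

theorem continuous_partialDeriv_partialDeriv (hf : ContDiff ℝ 2 f) (k : Fin 2) :
    Continuous (partialDeriv k (partialDeriv k f)) :=
  ((contDiff_partialDeriv hf k).continuous_fderiv (by norm_num)).clm_apply continuous_const

theorem continuous_gradNorm_fderiv (hf : ContDiff ℝ 2 f) :
    Continuous fun s => gradNorm (fderiv ℝ f s) := by
  have h := hf.continuous_fderiv (by norm_num)
  unfold gradNorm
  exact (((h.clm_apply continuous_const).pow 2).add ((h.clm_apply continuous_const).pow 2)).sqrt

theorem gradNorm_pos {ℓ : Plane →L[ℝ] ℝ} (h : ℓ ≠ 0) : 0 < gradNorm ℓ := by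
  refine Real.sqrt_pos.2 ?_
  by_contra hle
  refine h (ContinuousLinearMap.ext fun d => ?_)
  have h0 := sq_nonneg (ℓ (EuclideanSpace.single 0 1))
  have h1 := sq_nonneg (ℓ (EuclideanSpace.single 1 1))
  have e0 : ℓ (EuclideanSpace.single 0 1) = 0 := by
    rw [← sq_eq_zero_iff]; linarith
  have e1 : ℓ (EuclideanSpace.single 1 1) = 0 := by
    rw [← sq_eq_zero_iff]; linarith
  rw [apply_eq_coord, e0, e1]; simp

theorem fderiv_ne_zero_of_mem_levelSet (hnd : NonDegenerateAt f t u) {s : Plane}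
    (hs : s ∈ levelSet f t u) : fderiv ℝ f s ≠ 0 := fun h =>
  hnd.no_critical_point ⟨s, hs.1, hs.2, h⟩

/-- A level point in the interior of the excursion set would be a local minimum of `f` in the plane,
hence critical. -/
theorem excursionBoundary_eq_levelSet (hf : Continuous f) (hnd : NonDegenerateAt f t u) :
    excursionBoundary f t u = levelSet f t u := by
  ext s
  constructor
  · rintro ⟨h1, h2⟩
    exact ⟨h1, (frontier_le_subset_eq continuous_const hf h2).symm⟩
  · intro hs
    refine ⟨hs.1, subset_closure hs.2.ge, fun hint => ?_⟩
    refine fderiv_ne_zero_of_mem_levelSet hnd hs (IsLocalMin.fderiv_eq_zero ?_)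
    filter_upwards [mem_interior_iff_mem_nhds.1 hint] with x hx
    rw [hs.2]
    exact hx

theorem apply_eq_axis (ℓ : Plane →L[ℝ] ℝ) (d : Plane) (k : Fin 2) :
    ℓ d = d k * ℓ (EuclideanSpace.single k 1)
      + d (k + 1) * ℓ (EuclideanSpace.single (k + 1) 1) := by
  conv_lhs => rw [← axisPoint_eta k d, axisPoint]
  simp

/-- A regular level set has finitely many points with a tangent parallel to an axis, when the
second derivative in the direction of the tangent does not vanish there. -/
theorem finite_tangent_points (hf : ContDiff ℝ 2 f) (hnd : NonDegenerateAt f t u) (k : Fin 2) :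
    {s ∈ levelSet f t u | partialDeriv k f s = 0}.Finite := by
  by_contra hinf
  have hcp : IsCompact {s ∈ levelSet f t u | partialDeriv k f s = 0} :=
    (isCompact_levelSet hf.continuous).inter_right
      (isClosed_singleton.preimage (contDiff_partialDeriv hf k).continuous)
  obtain ⟨x, hx, hacc⟩ := Set.Infinite.exists_accPt_of_subset_isCompact hinf hcp subset_rfl
  have hd1 : HasFDerivAt f (fderiv ℝ f x) x :=
    (hf.differentiable (by norm_num) x).hasFDerivAt
  have hd2 : HasFDerivAt (partialDeriv k f) (fderiv ℝ (partialDeriv k f) x) x :=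
    ((contDiff_partialDeriv hf k).differentiable (by norm_num) x).hasFDerivAt
  have hxk : fderiv ℝ f x (EuclideanSpace.single k 1) = 0 := hx.2
  have hxk' : fderiv ℝ f x (EuclideanSpace.single (k + 1) 1) ≠ 0 := fun h0 =>
    fderiv_ne_zero_of_mem_levelSet hnd hx.1
      (ContinuousLinearMap.ext fun d => by rw [apply_eq_axis _ d k, hxk, h0]; simp)
  have hxkk : fderiv ℝ (partialDeriv k f) x (EuclideanSpace.single k 1) ≠ 0 := fun h0 =>
    hnd.no_flat_point k ⟨x, hx.1.1, sub_eq_zero.2 hx.1.2, hx.2, h0⟩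
  -- The derivative of (f, ∂ₖf) is triangular in the axes `k` and `k + 1`, with nonzero diagonal;
  -- being injective, it makes `x` isolated among the solutions of (f, ∂ₖf) = (u, 0).
  have hker : LinearMap.ker ((fderiv ℝ f x).prod (fderiv ℝ (partialDeriv k f) x)).toLinearMap
      = ⊥ := by
    rw [LinearMap.ker_eq_bot']
    intro d hd
    have h1 : fderiv ℝ f x d = 0 := congrArg Prod.fst hd
    have h2 : fderiv ℝ (partialDeriv k f) x d = 0 := congrArg Prod.snd hd
    rw [apply_eq_axis _ d k, hxk, mul_zero, zero_add, mul_eq_zero, or_iff_left hxk'] at h1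
    rw [apply_eq_axis _ d k, h1, zero_mul, add_zero, mul_eq_zero, or_iff_left hxkk] at h2
    rw [← axisPoint_eta k d, h1, h2, axisPoint, zero_smul, zero_smul, add_zero]
  obtain ⟨K, _, hK⟩ := LinearMap.exists_antilipschitzWith _ hker
  have hne := (hd1.prodMk hd2).eventually_ne (c := (u, 0)) ⟨K, hK⟩
  rw [accPt_iff_frequently_nhdsNE] at hacc
  obtain ⟨y, hy, hy'⟩ := (hacc.and_eventually hne).exists
  exact hy' (Prod.ext hy.1.2 hy.2)

theorem exists_dist_le_of_uniformContinuousOn {E : Type*} [PseudoMetricSpace E] {g : Plane → E}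
    (hg : Continuous g) {η : ℝ} (hη : 0 < η) :
    ∃ ρ > 0, ∀ s ∈ square t, ∀ z ∈ square t, dist s z ≤ ρ → dist (g s) (g z) ≤ η := by
  have := (isCompact_square t).uniformContinuousOn_of_continuous hg.continuousOn
  obtain ⟨ρ, hρ, h⟩ := Metric.uniformContinuousOn_iff.1 this η hη
  exact ⟨ρ / 2, half_pos hρ, fun s hs z hz hsz => (h s hs z hz (by linarith)).le⟩

variable {ε : ℝ} {m N : ℕ}

/-- The number of blocks with points of the level set near given points of the level set. -/
theorem card_corners_near_le (hf : Differentiable ℝ f) (hε : 0 < ε) (hm : 0 < m)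
    (hN : gridSize t ε = N + 1) {ρ η r : ℝ} (hη : 0 ≤ η) (hr : 0 ≤ r) (hrρ : r ≤ ρ)
    {A : Finset Plane} (hA : ∀ p ∈ A, p ∈ square t)
    (hg : ∀ p ∈ A, 0 < gradNorm (fderiv ℝ f p)) (hηg : ∀ p ∈ A, 8 * η ≤ gradNorm (fderiv ℝ f p))
    (h : ∀ s ∈ square t, ∀ p ∈ square t, dist s p ≤ ρ → dist (fderiv ℝ f s) (fderiv ℝ f p) ≤ η)
    {H : Finset (Fin 2 → ℕ)} (hH : H ⊆ corners t ε m) {z : (Fin 2 → ℕ) → Plane}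
    (hz : ∀ c ∈ H, z c ∈ closedBlock t ε m N c ∩ levelSet f t u)
    (hzA : ∀ c ∈ H, ∃ p ∈ A, dist (z c) p ≤ r) :
    (H.card : ℝ) ≤ A.card * (6 * (2 * r / (m * ε) + 3)) := by
  classical
  have hsub : H ⊆ A.biUnion fun p => H.filter fun c => dist (z c) p ≤ r := by
    intro c hc
    obtain ⟨p, hp, hd⟩ := hzA c hc
    exact Finset.mem_biUnion.2 ⟨p, hp, Finset.mem_filter.2 ⟨hc, hd⟩⟩
  have h1 : (H.card : ℝ) ≤ ∑ p ∈ A, ((H.filter fun c => dist (z c) p ≤ r).card : ℝ) := by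
    exact_mod_cast (Finset.card_le_card hsub).trans Finset.card_biUnion_le
  rw [← nsmul_eq_mul]
  refine h1.trans (Finset.sum_le_card_nsmul _ _ _ fun p hp => ?_)
  have hC : Convex ℝ (square t ∩ Metric.closedBall p r) :=
    convex_square.inter (convex_closedBall p r)
  have hmem : ∀ c ∈ H.filter fun c => dist (z c) p ≤ r,
      z c ∈ levelSet f t u ∩ Metric.closedBall p r := fun c hc => by
    rw [Finset.mem_filter] at hc
    exact ⟨(hz c hc.1).2, hc.2⟩
  -- One axis serves the whole ball around `p`, so the selected points project to it within a window
  -- of width 2r.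
  obtain ⟨k, hk⟩ := exists_norm_sub_le_coord (A := levelSet f t u ∩ Metric.closedBall p r)
    hη (hg p hp) (hηg p hp) fun P hP Q hQ => abs_apply_sub_le_of_levelSet hf hC
      (fun s hs => by
        rw [← dist_eq_norm]
        exact h s hs.1 p (hA p hp) (hs.2.trans hrρ)) ⟨hP.1.1, hP.2⟩ ⟨hQ.1.1, hQ.2⟩ hP.1.2 hQ.1.2
  refine card_corners_le (t := t) (N := N) hε hm (fun c hc l => ?_) (fun c hc => ?_) (by positivity)
    (fun c hc d hd => hk _ (hmem c hc) _ (hmem d hd)) fun c hc d hd => ?_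
  · exact ((mem_corners hN).1 (hH (Finset.mem_filter.1 hc).1) l).2
  · exact (hz c (Finset.mem_filter.1 hc).1).1
  · refine (abs_coord_le_norm (z c - z d) k).trans ?_
    rw [← dist_eq_norm]
    have := dist_triangle_right (z c) (z d) p
    have h2 : dist (z c) p ≤ r := (hmem c hc).2
    have h3 : dist (z d) p ≤ r := (hmem d hd).2
    linarith

/-! ### The global error bound -/

theorem perimeterEstimator_eq (hN : gridSize t ε = N + 1) :
    perimeterEstimator 2 f ε m t u = ∑ c ∈ corners t ε m,
      ε * ‖WithLp.toLp 2 ![blockCount f t ε u m N c 0, blockCount f t ε u m N c 1]‖ := by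
  simp only [perimeterEstimator, countH_eq hN, countV_eq hN]
  rw [sum_corners fun c =>
    ‖WithLp.toLp 2 ![blockCount f t ε u m N c 0, blockCount f t ε u m N c 1]‖, Finset.mul_sum]

/-- Writes the fine error, plus a nonnegative surplus, as mε times a small factor, so that it can be
summed over O(1/(mε)) blocks. -/
theorem block_error_eq {m g : ℝ} (hm : m ≠ 0) (hg : g ≠ 0) (ε η : ℝ) :
    m * ε * ((8 + 16 / g) * (1 / m + η))
      = 8 * ε + 4 * η / g * (4 * (m * ε)) + (8 * (m * ε) * η + 16 / g * ε) := by
  field_simp; ring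

theorem mul_count_mul {w : ℝ} (hw : w ≠ 0) (A r Y : ℝ) :
    A * (6 * (2 * r / w + 3)) * (w * Y) = 6 * A * (2 * r + 3 * w) * Y := by
  field_simp

set_option maxHeartbeats 1000000 in
/-- The error of the estimator for a nondegenerate path: the blocks near the points with a
tangent parallel to an axis contribute the first term, all the others the second. -/
theorem exists_error_bound (hf : ContDiff ℝ 2 f) (hnd : NonDegenerateAt f t u) :
    ∃ C D ρ₀ : ℝ, 0 < ρ₀ ∧ ∀ δ > 0, δ ≤ ρ₀ → ∀ η > 0, ∃ w₀ > 0, ∀ (ε : ℝ) (m N : ℕ),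
      0 < ε → 0 < m → gridSize t ε = N + 1 → N * ε = 2 * t → m * ε ≤ w₀ →
      μH[1] (levelSet f t u) ≠ ∞ ∧
      |perimeterEstimator 2 f ε m t u - (μH[1] (levelSet f t u)).toReal|
        ≤ C * (δ + m * ε) + D * (1 / m + η) := by
  classical
  have hfd : Differentiable ℝ f := hf.differentiable (by norm_num)
  have hLc : IsCompact (levelSet f t u) := isCompact_levelSet hf.continuous
  have hLs : levelSet f t u ⊆ square t := Set.sep_subset _ _
  have hpc : ∀ k, Continuous (partialDeriv k f) := fun k => (contDiff_partialDeriv hf k).continuous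
  have hppc := continuous_partialDeriv_partialDeriv hf
  obtain ⟨g, hg0, hg⟩ := exists_pos_le_of_isCompact hLc (continuous_gradNorm_fderiv hf).continuousOn
    fun s hs => gradNorm_pos (fderiv_ne_zero_of_mem_levelSet hnd hs)
  have hκ : ∀ k, ∃ κ > 0, ∀ s ∈ levelSet f t u,
      κ ≤ max |partialDeriv k f s| |partialDeriv k (partialDeriv k f) s| := fun k =>
    exists_pos_le_of_isCompact hLc ((hpc k).abs.max (hppc k).abs).continuousOn fun s hs => by
      rw [lt_max_iff, abs_pos, abs_pos]
      by_contra! h0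
      exact hnd.no_flat_point k ⟨s, hs.1, sub_eq_zero.2 hs.2, h0.1, h0.2⟩
  choose κ hκ0 hκ using hκ
  -- The tolerance η₀ does not depend on δ or η: g/8 makes projections bi-Lipschitz, and half the
  -- minimum of the κ keeps a first or second derivative from changing sign.
  set η₀ := min (g / 8) (min (κ 0) (κ 1) / 2)
  have hη₀0 : 0 < η₀ := lt_min (by positivity) (half_pos (lt_min (hκ0 0) (hκ0 1)))
  have hη₀g : 8 * η₀ ≤ g := by linarith [min_le_left (g / 8) (min (κ 0) (κ 1) / 2)]
  have hη₀κ : ∀ k, η₀ < κ k := by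
    have h1 := min_le_right (g / 8) (min (κ 0) (κ 1) / 2)
    have h2 := min_le_left (κ 0) (κ 1)
    have h3 := min_le_right (κ 0) (κ 1)
    have h4 := hκ0 0
    have h5 := hκ0 1
    have h6 : 0 < min (κ 0) (κ 1) := lt_min h4 h5
    rw [Fin.forall_fin_two]
    constructor <;> linarith
  obtain ⟨ρ₁, hρ₁, hu₁⟩ := exists_dist_le_of_uniformContinuousOn (t := t)
    (hf.continuous_fderiv (by norm_num)) hη₀0
  have hu₂ := fun k => exists_dist_le_of_uniformContinuousOn (t := t) (hppc k) hη₀0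
  choose ρ₂ hρ₂ hu₂ using hu₂
  obtain ⟨A, hAL, hAfin, hAcov⟩ := finite_cover_balls_of_compact hLc hρ₁
  have hFfin : (⋃ k, {s ∈ levelSet f t u | partialDeriv k f s = 0}).Finite :=
    Set.finite_iUnion (finite_tangent_points hf hnd)
  set F := hFfin.toFinset with hF
  have hFL : ∀ p ∈ F, p ∈ levelSet f t u := fun p hp => by
    rw [hF, Set.Finite.mem_toFinset, Set.mem_iUnion] at hp
    exact hp.choose_spec.1
  -- The constants use only the cover, the exceptional points and g, all fixed before δ and η.
  refine ⟨72 * F.card, 6 * hAfin.toFinset.card * (5 * ρ₁) * (8 + 16 / g), ρ₁, hρ₁,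
    fun δ hδ hδρ η hη => ?_⟩
  -- Off the δ-balls around `F` both partial derivatives are nonzero on a compact set; this bound
  -- depends on δ and only affects w₀.
  have hgood : ∀ k, ∃ κ' > 0, ∀ s ∈ levelSet f t u \ ⋃ p ∈ F, Metric.ball p δ,
      κ' ≤ |partialDeriv k f s| := fun k => by
    refine exists_pos_le_of_isCompact (hLc.diff (isOpen_biUnion fun _ _ => Metric.isOpen_ball))
      (hpc k).abs.continuousOn fun s hs => abs_pos.2 fun h0 => hs.2 ?_
    refine Set.mem_biUnion (x := s) ?_ (Metric.mem_ball_self hδ)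
    rw [hF]
    exact hFfin.mem_toFinset.2 (Set.mem_iUnion.2 ⟨k, hs.1, h0⟩)
  choose κ' hκ'0 hκ' using hgood
  set η₁ := min η (min η₀ (min (κ' 0) (κ' 1) / 2))
  have hm0 : 0 < min (κ' 0) (κ' 1) := lt_min (hκ'0 0) (hκ'0 1)
  have hη₁0 : 0 < η₁ := lt_min hη (lt_min hη₀0 (half_pos hm0))
  have hη₁η : η₁ ≤ η := min_le_left _ _
  have hη₁η₀ : η₁ ≤ η₀ := (min_le_right _ _).trans (min_le_left _ _)
  have hη₁κ : ∀ k, η₁ < κ' k := by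
    have h1 : η₁ ≤ min (κ' 0) (κ' 1) / 2 := (min_le_right _ _).trans (min_le_right _ _)
    have h2 := min_le_left (κ' 0) (κ' 1)
    have h3 := min_le_right (κ' 0) (κ' 1)
    rw [Fin.forall_fin_two]
    constructor <;> linarith
  obtain ⟨ρ₃, hρ₃, hu₃⟩ := exists_dist_le_of_uniformContinuousOn (t := t)
    (hf.continuous_fderiv (by norm_num)) hη₁0
  -- Halved because two points of a block are at distance at most 2mε.
  set w₀ := min (min ρ₁ ρ₃) (min (ρ₂ 0) (ρ₂ 1)) / 2 with hw₀
  have hw₀0 : 0 < w₀ := half_pos (lt_min (lt_min hρ₁ hρ₃) (lt_min (hρ₂ 0) (hρ₂ 1)))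
  have hw₁ : 2 * w₀ ≤ ρ₁ := by
    have := (min_le_left (min ρ₁ ρ₃) (min (ρ₂ 0) (ρ₂ 1))).trans (min_le_left _ _); linarith
  have hw₃ : 2 * w₀ ≤ ρ₃ := by
    have := (min_le_left (min ρ₁ ρ₃) (min (ρ₂ 0) (ρ₂ 1))).trans (min_le_right _ _); linarith
  have hw₂ : ∀ k, 2 * w₀ ≤ ρ₂ k := by
    have h1 := (min_le_right (min ρ₁ ρ₃) (min (ρ₂ 0) (ρ₂ 1))).trans (min_le_left _ _)
    have h2 := (min_le_right (min ρ₁ ρ₃) (min (ρ₂ 0) (ρ₂ 1))).trans (min_le_right _ _)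
    rw [Fin.forall_fin_two]
    constructor <;> linarith
  refine ⟨w₀, hw₀0, fun ε m N hε hm hN hNt hw => ?_⟩
  have hw0 : 0 < m * ε := by positivity
  set H := (corners t ε m).filter fun c => (closedBlock t ε m N c ∩ levelSet f t u).Nonempty
    with hH
  have hex : ∀ c : Fin 2 → ℕ, ∃ z, c ∈ H → z ∈ closedBlock t ε m N c ∩ levelSet f t u := by
    intro c
    by_cases hc : c ∈ H
    · exact ⟨(Finset.mem_filter.1 hc).2.choose, fun _ => (Finset.mem_filter.1 hc).2.choose_spec⟩
    -- The value outside `H` is arbitrary.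
    · exact ⟨0, fun h => absurd h hc⟩
  choose z hz using hex
  have hclose : ∀ c ∈ H, ∀ s ∈ closedBlock t ε m N c,
      s ∈ square t ∧ z c ∈ square t ∧ dist s (z c) ≤ 2 * w₀ := fun c hc s hs =>
    ⟨closedBlock_subset_square hε hNt c hs, hLs (hz c hc).2, by
      rw [dist_eq_norm]
      exact (norm_sub_le_of_mem_closedBlock hε hs (hz c hc).1).trans (by linarith)⟩
  have hd₁ : ∀ c ∈ H, ∀ s ∈ closedBlock t ε m N c,
      ‖fderiv ℝ f s - fderiv ℝ f (z c)‖ ≤ η₀ := fun c hc s hs => by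
    obtain ⟨h1, h2, h3⟩ := hclose c hc s hs
    rw [← dist_eq_norm]
    exact hu₁ s h1 _ h2 (h3.trans hw₁)
  have hd₃ : ∀ c ∈ H, ∀ s ∈ closedBlock t ε m N c,
      ‖fderiv ℝ f s - fderiv ℝ f (z c)‖ ≤ η₁ := fun c hc s hs => by
    obtain ⟨h1, h2, h3⟩ := hclose c hc s hs
    rw [← dist_eq_norm]
    exact hu₃ s h1 _ h2 (h3.trans hw₃)
  have hgz : ∀ c ∈ H, g ≤ gradNorm (fderiv ℝ f (z c)) := fun c hc => hg _ (hz c hc).2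
  have hle : ∀ c ∈ H, μH[1] (levelSet f t u ∩ block t ε m c) ≤ ENNReal.ofReal (4 * (m * ε)) :=
    fun c hc => hausdorffMeasure_block_le hfd hε hNt hη₀0.le (hg0.trans_le (hgz c hc))
      (hη₀g.trans (hgz c hc)) (hd₁ c hc)
  have hmiss : ∀ c ∈ corners t ε m, c ∉ H → closedBlock t ε m N c ∩ levelSet f t u = ∅ :=
    fun c hc hcH => by
      rw [← Set.not_nonempty_iff_eq_empty]
      exact fun h => hcH (Finset.mem_filter.2 ⟨hc, h⟩)
  have hmiss' : ∀ c ∈ corners t ε m, c ∉ H → levelSet f t u ∩ block t ε m c = ∅ :=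
    fun c hc hcH => by
      refine Set.subset_empty_iff.1 ?_
      rw [← hmiss c hc hcH]
      exact fun s hs => ⟨block_subset_closedBlock hε hNt c hs.2, hs.1⟩
  have hfin : ∀ c ∈ corners t ε m, μH[1] (levelSet f t u ∩ block t ε m c) ≠ ∞ := by
    intro c hc
    by_cases hcH : c ∈ H
    · exact ne_top_of_le_ne_top ENNReal.ofReal_ne_top (hle c hcH)
    · rw [hmiss' c hc hcH]; simp
  have hsum := hausdorffMeasure_eq_sum hε hm hN hNt hLc.measurableSet hLs
  refine ⟨by rw [hsum]; exact ENNReal.sum_ne_top.2 hfin, ?_⟩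
  rw [hsum, ENNReal.toReal_sum hfin, perimeterEstimator_eq hN, ← Finset.sum_sub_distrib]
  set e : (Fin 2 → ℕ) → ℝ := fun c =>
    ε * ‖WithLp.toLp 2 ![blockCount f t ε u m N c 0, blockCount f t ε u m N c 1]‖
      - (μH[1] (levelSet f t u ∩ block t ε m c)).toReal with he
  have he0 : ∀ c ∈ corners t ε m, c ∉ H → e c = 0 := fun c hc hcH => by
    have := fun k => blockCount_eq_zero hf.continuous hε hNt (hmiss c hc hcH) k
    simp [he, this, hmiss' c hc hcH, norm_pair]
  have hHs : H ⊆ corners t ε m := Finset.filter_subset _ _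
  have hsumH : ∑ c ∈ corners t ε m, e c = ∑ c ∈ H, e c :=
    (Finset.sum_subset hHs he0).symm
  rw [hsumH]
  -- Both the estimate and the length lie between 0 and 4mε.
  have hebad : ∀ c ∈ H, |e c| ≤ 4 * (m * ε) := fun c hc => by
    have h1 := ENNReal.toReal_le_of_le_ofReal (by positivity) (hle c hc)
    have h2 : ε * ‖WithLp.toLp 2 ![blockCount f t ε u m N c 0, blockCount f t ε u m N c 1]‖
        ≤ 4 * (m * ε) := by
      refine norm_blockCount_le hf hε hNt (hd₁ c hc) (fun k s hs => ?_) fun k => ?_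
      · obtain ⟨h1, h2, h3⟩ := hclose c hc s hs
        rw [← Real.dist_eq]
        exact hu₂ k s h1 _ h2 (h3.trans (hw₂ k))
      · exact lt_max_iff.1 ((hη₀κ k).trans_le (hκ k _ (hz c hc).2))
    have h3 : 0 ≤ (μH[1] (levelSet f t u ∩ block t ε m c)).toReal := ENNReal.toReal_nonneg
    have h4 : 0 ≤ ε * ‖WithLp.toLp 2 ![blockCount f t ε u m N c 0,
      blockCount f t ε u m N c 1]‖ := by positivity
    rw [abs_le]; simp only [he]; constructor <;> linarith
  set B := H.filter fun c => z c ∈ ⋃ p ∈ F, Metric.ball p δ with hB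
  have hegood : ∀ c ∈ H \ B, |e c| ≤ m * ε * ((8 + 16 / g) * (1 / m + η)) := fun c hc => by
    rw [Finset.mem_sdiff] at hc
    have hcB : z c ∉ ⋃ p ∈ F, Metric.ball p δ := fun h => hc.2 (Finset.mem_filter.2 ⟨hc.1, h⟩)
    have hcg := hgz c hc.1
    have h1 := abs_norm_blockCount_sub_le (u := u) (c := c) hfd hε hNt
      (fun k => ((mem_corners hN).1 (hHs hc.1) k).1) hη₁0.le (hg0.trans_le hcg)
      (by linarith) (hd₃ c hc.1)
      (fun k => (hη₁κ k).trans_le (hκ' k _ ⟨(hz c hc.1).2, hcB⟩))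
    refine h1.trans ?_
    have h2 : 4 * η₁ / gradNorm (fderiv ℝ f (z c)) * (4 * (m * ε)) ≤ 4 * η / g * (4 * (m * ε)) := by
      gcongr
    have hm' : (0 : ℝ) < m := by exact_mod_cast hm
    have h3 : m * ε * ((8 + 16 / g) * (1 / m + η))
        = 8 * ε + 4 * η / g * (4 * (m * ε)) + (8 * (m * ε) * η + 16 / g * ε) :=
      block_error_eq hm'.ne' hg0.ne' ε η
    have h4 : 0 ≤ 8 * (m * ε) * η + 16 / g * ε := by positivity
    rw [h3]
    linarith
  have hcardB : (B.card : ℝ) ≤ F.card * (6 * (2 * δ / (m * ε) + 3)) := by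
    refine card_corners_near_le hfd hε hm hN hη₀0.le hδ.le hδρ (fun p hp => hLs (hFL p hp))
      (fun p hp => hg0.trans_le (hg p (hFL p hp))) (fun p hp => hη₀g.trans (hg p (hFL p hp)))
      hu₁ ((Finset.filter_subset _ _).trans hHs) (fun c hc => hz c (Finset.mem_filter.1 hc).1)
      fun c hc => ?_
    have := (Finset.mem_filter.1 hc).2
    simp only [Set.mem_iUnion, exists_prop, Metric.mem_ball] at this
    obtain ⟨p, hp, hd⟩ := this
    exact ⟨p, hp, hd.le⟩
  have hcardH : (H.card : ℝ) ≤ hAfin.toFinset.card * (6 * (2 * ρ₁ / (m * ε) + 3)) := by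
    refine card_corners_near_le hfd hε hm hN hη₀0.le hρ₁.le le_rfl
      (fun p hp => hLs (hAL (hAfin.mem_toFinset.1 hp)))
      (fun p hp => hg0.trans_le (hg p (hAL (hAfin.mem_toFinset.1 hp))))
      (fun p hp => hη₀g.trans (hg p (hAL (hAfin.mem_toFinset.1 hp))))
      hu₁ hHs hz fun c hc => ?_
    have := hAcov (hz c hc).2
    simp only [Set.mem_iUnion, exists_prop, Metric.mem_ball] at this
    obtain ⟨p, hp, hd⟩ := this
    exact ⟨p, hAfin.mem_toFinset.2 hp, hd.le⟩
  have hBH : B ⊆ H := Finset.filter_subset _ _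
  set X := (8 + 16 / g) * (1 / (m : ℝ) + η)
  have hX0 : 0 ≤ X := by positivity
  have hcardG : ((H \ B).card : ℝ) ≤ H.card := by
    exact_mod_cast Finset.card_le_card Finset.sdiff_subset
  have s1 : ∑ c ∈ B, |e c| ≤ 72 * F.card * (δ + m * ε) := by
    calc ∑ c ∈ B, |e c| ≤ B.card • (4 * (m * ε)) :=
          Finset.sum_le_card_nsmul _ _ _ fun c hc => hebad c (hBH hc)
      _ ≤ F.card * (6 * (2 * δ / (m * ε) + 3)) * (4 * (m * ε)) := by
          rw [nsmul_eq_mul]; gcongr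
      _ = F.card * (48 * δ + 72 * (m * ε)) := by
          rw [mul_comm 4, mul_count_mul hw0.ne']; ring
      _ ≤ F.card * (72 * δ + 72 * (m * ε)) := by gcongr; norm_num
      _ = _ := by ring
  have s2 : ∑ c ∈ H \ B, |e c| ≤ 6 * hAfin.toFinset.card * (5 * ρ₁) * X := by
    calc ∑ c ∈ H \ B, |e c| ≤ (H \ B).card • (m * ε * X) :=
          Finset.sum_le_card_nsmul _ _ _ hegood
      _ ≤ hAfin.toFinset.card * (6 * (2 * ρ₁ / (m * ε) + 3)) * (m * ε * X) := by
          rw [nsmul_eq_mul]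
          gcongr
          exact hcardG.trans hcardH
      _ = 6 * hAfin.toFinset.card * (2 * ρ₁ + 3 * (m * ε)) * X :=
          mul_count_mul hw0.ne' _ _ _
      -- Here mε ≤ w₀ ≤ ρ₁/2.
      _ ≤ 6 * hAfin.toFinset.card * (5 * ρ₁) * X := by gcongr; linarith
  calc |∑ c ∈ H, e c| ≤ ∑ c ∈ H, |e c| := Finset.abs_sum_le_sum_abs _ _
    _ = ∑ c ∈ H \ B, |e c| + ∑ c ∈ B, |e c| := (Finset.sum_sdiff hBH).symm
    _ ≤ _ := by rw [mul_assoc _ (8 + 16 / g)]; linarith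

/-! ### Passage to the limit -/

theorem exists_mul_eq_of_vertices_subset (h : vertices t ⊆ grid t ε) :
    ∃ N : ℕ, N * ε = 2 * t := by
  obtain ⟨⟨i, j, hij⟩, -⟩ := h (show !₂[t, t] ∈ vertices t by simp [vertices])
  refine ⟨i, ?_⟩
  have := congrArg (fun s : Plane => s 0) hij
  simp [gridPoint] at this
  linarith

theorem tendsto_perimeterEstimator (ht : 0 < t) (hf : ContDiff ℝ 2 f)
    (hnd : NonDegenerateAt f t u) {m : ℕ → ℕ} (hm_pos : ∀ n, 0 < m n)
    (hm : Tendsto m atTop atTop) {ε : ℕ → ℝ} (hε_pos : ∀ n, 0 < ε n)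
    (hmε : Tendsto (fun n => (m n : ℝ) * ε n) atTop (𝓝 0))
    (hgrid : ∀ n, vertices t ⊆ grid t (ε n)) :
    perimeter f t u ≠ ∞ ∧
      Tendsto (fun n => perimeterEstimator 2 f (ε n) (m n) t u) atTop
        (𝓝 (perimeter f t u).toReal) := by
  rw [perimeter, excursionBoundary_eq_levelSet hf.continuous hnd]
  obtain ⟨C, D, ρ₀, hρ₀, h⟩ := exists_error_bound hf hnd
  have hN : ∀ n, ∃ N : ℕ, gridSize t (ε n) = N + 1 ∧ N * ε n = 2 * t := fun n => by
    obtain ⟨N, hN⟩ := exists_mul_eq_of_vertices_subset (hgrid n)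
    refine ⟨N, ?_, hN⟩
    rw [gridSize_eq ht.le (hε_pos n), ← hN, mul_div_cancel_right₀ _ (hε_pos n).ne',
      Nat.floor_natCast]
  have key : ∀ δ > 0, δ ≤ ρ₀ → ∀ η > 0, ∀ᶠ n in atTop, μH[1] (levelSet f t u) ≠ ∞ ∧
      |perimeterEstimator 2 f (ε n) (m n) t u - (μH[1] (levelSet f t u)).toReal|
        ≤ C * (δ + m n * ε n) + D * (1 / m n + η) := by
    intro δ hδ hδρ η hη
    obtain ⟨w₀, hw₀, h⟩ := h δ hδ hδρ η hη
    filter_upwards [hmε.eventually_le_const hw₀] with n hn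
    obtain ⟨N, hN1, hN2⟩ := hN n
    exact h (ε n) (m n) N (hε_pos n) (hm_pos n) hN1 hN2 hn
  refine ⟨(key ρ₀ hρ₀ le_rfl 1 one_pos).exists.choose_spec.1, Metric.tendsto_atTop'.2 ?_⟩
  intro r hr
  -- The bound is used with η = δ; its limit in n is Cδ + Dδ, which is continuous and vanishes at δ
  -- = 0.
  have hδη : ∃ δ > 0, δ ≤ ρ₀ ∧ C * δ + D * δ < r := by
    have hc : Tendsto (fun δ : ℝ => C * δ + D * δ) (𝓝[>] 0) (𝓝 0) := by
      refine tendsto_nhdsWithin_of_tendsto_nhds ?_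
      have : Continuous fun δ : ℝ => C * δ + D * δ := by fun_prop
      simpa using this.tendsto 0
    have hev : ∀ᶠ δ : ℝ in 𝓝[>] 0, δ ∈ Set.Ioc 0 ρ₀ := Ioc_mem_nhdsGT hρ₀
    obtain ⟨δ, h1, h2⟩ := ((hc.eventually_lt_const hr).and hev).exists
    exact ⟨δ, h2.1, h2.2, h1⟩
  obtain ⟨δ, hδ, hδρ, hlt⟩ := hδη
  have hlim : Tendsto (fun n => C * (δ + m n * ε n) + D * (1 / m n + δ)) atTop
      (𝓝 (C * (δ + 0) + D * (0 + δ))) :=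
    ((hmε.const_add δ).const_mul C).add
      (((tendsto_one_div_atTop_nhds_zero_nat.comp hm).add_const δ).const_mul D)
  rw [add_zero, zero_add] at hlim
  obtain ⟨n₀, hn₀⟩ := eventually_atTop.1
    ((key δ hδ hδρ δ hδ).and (hlim.eventually_lt_const hlt))
  refine ⟨n₀, fun n hn => ?_⟩
  rw [Real.dist_eq]
  exact (hn₀ n hn.le).1.2.trans_lt (hn₀ n hn.le).2

end Path

end Excursion

end

theorem corollary1 {Ω : Type*} [MeasurableSpace Ω] (P : Measure Ω) [IsProbabilityMeasure P]
    (X : Ω → Excursion.Plane → ℝ) (t : ℝ) (ht : 0 < t)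
    (hX : Excursion.IsSmoothField X) (hX' : Excursion.IsNonDegenerateField P X t)
    (m : ℕ → ℕ) (hm_pos : ∀ n, 0 < m n) (hm_mono : Monotone m) (hm : Tendsto m atTop atTop)
    (ε : ℕ → ℝ) (hε_pos : ∀ n, 0 < ε n)
    (hmε : Tendsto (fun n => (m n : ℝ) * ε n) atTop (𝓝 0))
    (hgrid : ∀ n, Excursion.vertices t ⊆ Excursion.grid t (ε n))
    (u : ℝ) :
    ∀ᵐ ω ∂P, Excursion.perimeter (X ω) t u ≠ ∞ ∧
      Tendsto (fun n => Excursion.perimeterEstimator 2 (X ω) (ε n) (m n) t u) atTop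
        (𝓝 (Excursion.perimeter (X ω) t u).toReal) := by
  filter_upwards [hX' u] with ω hω
  exact Excursion.tendsto_perimeterEstimator ht (hX.contDiff ω) hω hm_pos hm hε_pos hmε hgrid
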